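/- Let $G$ be an étale groupoid, that is, a groupoid with a Hausdorff, locally compact, second countable topology such that composition and inversion are continuous and the range and source maps $r,s:G\to G^{(0)}$ are local homeomorphisms. Let $C^*_{\rm red}(G)$ be the completion of the convolution $*$-algebra $C_c(G)$ in the norm of its regular representation $f\mapsto(\xi\mapsto f\times\xi)$ on $\ell^2(G)=\bigoplus_{u\in G^{(0)}}\ell^2(s^{-1}(u))$. View $C_0(G^{(0)})\subset C^*_{\rm red}(G)$ as the closure of $C_c(G^{(0)})\subset C_c(G)$, and let $\mathbb E_{\rm red}:C^*_{\rm red}(G)\to C_0(G^{(0)})$ be the natural conditional expectation, the continuous extension of the restriction map $f\mapsto f|_{G^{(0)}}$, $f\in C_c(G)$. Let $\mu$ be a Radon probability measure on $G^{(0)}$, and let $\phi_\mu(h)=\int_{G^{(0)}}h\,d\mu$ be the associated state on $B=C_0(G^{(0)})$. An open bisection is an open set $X\subset G$ on which $r$ and $s$ restrict to homeomorphisms onto open subsets of $G$. For $n\in C^*_{\rm red}(G)$, the state $\phi_\mu$ is $n$-invariant if, for every $b\in B$, the elements $nbn^*$ and $n^*nb$ belong to $B$ and $\phi_\mu(nbn^*)=\phi_\mu(n^*nb)$.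 (The two elements belong to $B$ automatically for the $n$ considered below.) Then the following conditions are equivalent: (i) $\mu$ is totally balanced: $\mu(XAX^{-1})=\mu(s(X)\cap A)$ for every open bisection $X\subset G$ and every Borel set $A\subset G^{(0)}$; (ii) $\phi_\mu$ is elementary invariant: $\phi_\mu$ is $n$-invariant for every $n\in C_c(G)$ that is supported in an open bisection; (iii) $\phi_\mu$ is fully invariant: $\phi_\mu$ is $n$-invariant for every $n\in C^*_{\rm red}(G)$ such that $nBn^*\cup n^*Bn\subset B$; (iv) $\phi_\mu\circ\mathbb E_{\rm red}$ is a tracial state on $C^*_{\rm red}(G)$. -/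

import Mathlib

open Set Filter Topology MeasureTheory
open scoped ZeroAtInfty CompactlySupported ENNReal

namespace GroupoidCStar

/-- A groupoid: a set with a set of composable pairs, a composition and an inversion.
The composition is only meaningful on composable pairs; its values on other pairs are
never used. -/
class AlgGroupoid (G : Type*) where
  composable : Set (G × G)
  mul : G → G → G
  inv : G → G
  mul_assoc : ∀ a b c : G, (a, b) ∈ composable → (b, c) ∈ composable →
    (mul a b, c) ∈ composable ∧ (a, mul b c) ∈ composable ∧
      mul a (mul b c) = mul (mul a b) c
  inv_inv : ∀ a : G, inv (inv a) = a
  composable_inv : ∀ a : G, (a, inv a) ∈ composable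
  inv_mul_cancel : ∀ a b : G, (a, b) ∈ composable → mul (inv a) (mul a b) = b
  mul_inv_cancel : ∀ a b : G, (a, b) ∈ composable → mul (mul a b) (inv b) = a

section Algebra

variable {G : Type*} [AlgGroupoid G]

/-- The set of composable pairs. -/
def composable (G : Type*) [AlgGroupoid G] : Set (G × G) := AlgGroupoid.composable

/-- Composition (meaningful on composable pairs). -/
def gmul (a b : G) : G := AlgGroupoid.mul a b

/-- Inversion. -/
def ginv (a : G) : G := AlgGroupoid.inv a

/-- The range `r a = a a⁻¹`. -/
def rg (a : G) : G := gmul a (ginv a)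

/-- The source `s a = a⁻¹ a`. -/
def sr (a : G) : G := gmul (ginv a) a

/-- The unit space. -/
def units (G : Type*) [AlgGroupoid G] : Set G :=
  {u | (u, u) ∈ composable G ∧ gmul u u = u}

theorem ginv_ginv (a : G) : ginv (ginv a) = a := AlgGroupoid.inv_inv a

theorem comp_ginv (a : G) : (a, ginv a) ∈ composable G := AlgGroupoid.composable_inv a

theorem ginv_comp (a : G) : (ginv a, a) ∈ composable G := by
  simpa [ginv_ginv] using comp_ginv (ginv a)

theorem gassoc {a b c : G} (h : (a, b) ∈ composable G) (k : (b, c) ∈ composable G) :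
    (gmul a b, c) ∈ composable G ∧ (a, gmul b c) ∈ composable G ∧
      gmul a (gmul b c) = gmul (gmul a b) c := AlgGroupoid.mul_assoc a b c h k

theorem ginv_gmul {a b : G} (h : (a, b) ∈ composable G) : gmul (ginv a) (gmul a b) = b :=
  AlgGroupoid.inv_mul_cancel a b h

theorem gmul_ginv {a b : G} (h : (a, b) ∈ composable G) : gmul (gmul a b) (ginv b) = a :=
  AlgGroupoid.mul_inv_cancel a b h

theorem rg_comp (a : G) : (rg a, a) ∈ composable G := (gassoc (comp_ginv a) (ginv_comp a)).1

theorem comp_sr (a : G) : (a, sr a) ∈ composable G := (gassoc (comp_ginv a) (ginv_comp a)).2.1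

theorem rg_gmul_self (a : G) : gmul (rg a) a = a := by
  simpa [ginv_ginv, rg] using gmul_ginv (comp_ginv a)

theorem gmul_sr_self (a : G) : gmul a (sr a) = a := by
  simpa [ginv_ginv, sr] using ginv_gmul (ginv_comp a)

theorem rg_ginv (a : G) : rg (ginv a) = sr a := by simp [rg, sr, ginv_ginv]

theorem sr_ginv (a : G) : sr (ginv a) = rg a := by simp [rg, sr, ginv_ginv]

/-- A pair is composable exactly when the source of the first element is the range of
the second. -/
theorem composable_iff {a b : G} : (a, b) ∈ composable G ↔ sr a = rg b := by
  constructor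
  · intro h
    have h1 := gassoc (ginv_comp a) h
    have h2 := gassoc h1.2.1 (b := gmul a b) (c := ginv b) (gassoc h (comp_ginv b)).1
    rw [ginv_gmul h, gmul_ginv h] at h2
    exact h2.2.2
  · intro h
    have h1 := gassoc (comp_sr a) (h ▸ rg_comp b : (sr a, b) ∈ composable G)
    have h2 := h1.2.1
    rwa [h, rg_gmul_self] at h2

theorem rg_gmul {a b : G} (h : sr a = rg b) : rg (gmul a b) = rg a := by
  have hc := composable_iff.2 h
  have h1 := gassoc (rg_comp a) hc
  have h2 := composable_iff.1 h1.2.1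
  have h3 : sr (rg a) = rg a := by
    have := composable_iff.1 (gassoc (comp_ginv a) (ginv_comp a)).1
    simpa [rg] using this
  rw [← h2, h3]

theorem sr_gmul {a b : G} (h : sr a = rg b) : sr (gmul a b) = sr b := by
  have hc := composable_iff.2 h
  have h3 : rg (ginv b) = sr (gmul a b) := by
    exact (composable_iff.1 (gassoc hc (comp_ginv b)).1).symm
  rw [← h3, rg_ginv]

theorem sr_rg (a : G) : sr (rg a) = rg a := by
  simpa [rg, sr_ginv] using sr_gmul (a := a) (b := ginv a) (rg_ginv a).symm

theorem rg_rg (a : G) : rg (rg a) = rg a := by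
  simpa [rg] using rg_gmul (a := a) (b := ginv a) (rg_ginv a).symm

theorem rg_sr (a : G) : rg (sr a) = sr a := by rw [← rg_ginv a, rg_rg]

theorem sr_sr (a : G) : sr (sr a) = sr a := by rw [← rg_ginv a, sr_rg]

theorem rg_mem_units (a : G) : rg a ∈ units G := by
  refine ⟨composable_iff.2 (by rw [sr_rg, rg_rg]), ?_⟩
  conv_lhs => rw [← rg_rg a]
  simpa [rg_rg] using rg_gmul_self (rg a)

theorem sr_mem_units (a : G) : sr a ∈ units G := by
  rw [← rg_ginv]; exact rg_mem_units _

theorem rg_of_mem_units {u : G} (hu : u ∈ units G) : rg u = u := by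
  have := gmul_ginv hu.1
  rw [hu.2] at this
  exact this

theorem sr_of_mem_units {u : G} (hu : u ∈ units G) : sr u = u := by
  rw [← rg_of_mem_units hu, sr_rg]

theorem mem_units_iff {u : G} : u ∈ units G ↔ rg u = u :=
  ⟨rg_of_mem_units, fun h => h ▸ rg_mem_units u⟩

theorem ginv_of_mem_units {u : G} (hu : u ∈ units G) : ginv u = u := by
  have h1 := gmul_sr_self (ginv u)
  rw [sr_ginv, rg_of_mem_units hu] at h1
  rw [← h1]
  exact sr_of_mem_units hu

theorem ginv_gmul_eq {a b c : G} (h : sr a = rg b) (k : gmul a b = c) :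
    gmul (ginv a) c = b := by
  rw [← k]; exact ginv_gmul (composable_iff.2 h)

theorem gmul_ginv_gmul {a c : G} (h : rg a = rg c) : gmul a (gmul (ginv a) c) = c := by
  have := ginv_gmul (a := ginv a) (b := c) (composable_iff.2 (by rw [sr_ginv, h]))
  rwa [ginv_ginv] at this

/-- The range map into the unit space. -/
def rgU (a : G) : units G := ⟨rg a, rg_mem_units a⟩

/-- The source map into the unit space. -/
def srU (a : G) : units G := ⟨sr a, sr_mem_units a⟩

/-- The set product `A B` in a groupoid. -/
def setMul (A B : Set G) : Set G :=
  {c | ∃ a ∈ A, ∃ b ∈ B, (a, b) ∈ composable G ∧ gmul a b = c}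

/-- The set `A⁻¹` in a groupoid. -/
def setInv (A : Set G) : Set G := ginv '' A

end Algebra

/-- Étale groupoids: Hausdorff, locally compact, second countable, with continuous
operations, whose range and source maps are local homeomorphisms onto the unit space. -/
class EtaleGroupoid (G : Type*) [TopologicalSpace G] [AlgGroupoid G] : Prop
    extends T2Space G, LocallyCompactSpace G, SecondCountableTopology G where
  continuousOn_gmul : ContinuousOn (fun p : G × G => gmul p.1 p.2) (composable G)
  continuous_ginv : Continuous (ginv : G → G)
  isLocalHomeomorph_rgU : IsLocalHomeomorph (rgU : G → units G)
  isLocalHomeomorph_srU : IsLocalHomeomorph (srU : G → units G)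

/-- Open bisections: open sets on which range and source are homeomorphisms onto open
subsets of `G`. -/
def IsOpenBisection {G : Type*} [TopologicalSpace G] [AlgGroupoid G] (X : Set G) : Prop :=
  IsOpen X ∧ IsOpenEmbedding (X.domRestrict (rg : G → G)) ∧
    IsOpenEmbedding (X.domRestrict (sr : G → G))

theorem IsOpenBisection.injOn_rg {G : Type*} [TopologicalSpace G] [AlgGroupoid G] {X : Set G}
    (hX : IsOpenBisection X) : InjOn rg X :=
  injOn_iff_injective.2 hX.2.1.injective

theorem IsOpenBisection.injOn_sr {G : Type*} [TopologicalSpace G] [AlgGroupoid G] {X : Set G}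
    (hX : IsOpenBisection X) : InjOn sr X :=
  injOn_iff_injective.2 hX.2.2.injective

section Topology

variable {G : Type*} [TopologicalSpace G] [AlgGroupoid G] [EtaleGroupoid G]

theorem continuous_rgU : Continuous (rgU : G → units G) :=
  EtaleGroupoid.isLocalHomeomorph_rgU.continuous

theorem continuous_srU : Continuous (srU : G → units G) :=
  EtaleGroupoid.isLocalHomeomorph_srU.continuous

theorem continuous_rg : Continuous (rg : G → G) := continuous_subtype_val.comp continuous_rgU

theorem continuous_sr : Continuous (sr : G → G) := continuous_subtype_val.comp continuous_srU

theorem isClosed_units : IsClosed (units G) := by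
  have : units G = {u | rg u = u} := by ext u; exact mem_units_iff
  rw [this]
  exact isClosed_eq continuous_rg continuous_id

theorem isOpen_units : IsOpen (units G) := by
  rw [isOpen_iff_mem_nhds]
  intro u hu
  obtain ⟨e, he, hr⟩ := EtaleGroupoid.isLocalHomeomorph_rgU (G := G) u
  have hu' : rg u ∈ e.source := by rwa [rg_of_mem_units hu]
  filter_upwards [e.open_source.mem_nhds he,
    (e.open_source.preimage continuous_rg).mem_nhds hu'] with a ha ha'
  rw [mem_units_iff]
  refine e.injOn ha' ha ?_
  rw [← hr]
  exact Subtype.ext (rg_rg a)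

instance : LocallyCompactSpace (units G) := isClosed_units.isClosedEmbedding_subtypeVal.locallyCompactSpace

theorem isClosed_composable : IsClosed (composable G) := by
  have : composable G = {p | sr p.1 = rg p.2} := by ext ⟨a, b⟩; exact composable_iff
  rw [this]
  exact isClosed_eq (continuous_sr.comp continuous_fst) (continuous_rg.comp continuous_snd)

theorem exists_isOpenBisection (a : G) : ∃ X : Set G, IsOpenBisection X ∧ a ∈ X := by
  obtain ⟨e, he, hr⟩ := EtaleGroupoid.isLocalHomeomorph_rgU (G := G) a
  obtain ⟨d, hd, hs⟩ := EtaleGroupoid.isLocalHomeomorph_srU (G := G) a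
  have key : ∀ e : OpenPartialHomeomorph G (units G), ∀ X : Set G, IsOpen X → X ⊆ e.source →
      IsOpenEmbedding (X.domRestrict (fun a => (e a : G))) := by
    intro e X hX hXe
    refine IsOpenEmbedding.comp isOpen_units.isOpenEmbedding_subtypeVal
      (f := X.domRestrict e) ?_
    refine .of_continuous_injective_isOpenMap
      ((e.continuousOn.mono hXe).domRestrict) ?_ ?_
    · exact (e.injOn.mono hXe).injective
    · intro U hU
      have : X.domRestrict e '' U = e '' (Subtype.val '' U) := by
        rw [Set.image_image]; rfl
      rw [this]
      refine e.isOpen_image_of_subset_source (hX.isOpenMap_subtype_val U hU) ?_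
      rintro _ ⟨x, -, rfl⟩
      exact hXe x.2
  have hX : IsOpen (e.source ∩ d.source) := e.open_source.inter d.open_source
  refine ⟨e.source ∩ d.source, ⟨hX, ?_, ?_⟩, he, hd⟩
  · have := key e _ hX inter_subset_left
    rw [← hr] at this
    exact this
  · have := key d _ hX inter_subset_right
    rw [← hs] at this
    exact this

/-- Every function in `C_c(G)` is a finite sum of functions supported in open bisections. -/
theorem cc_induction {P : C_c(G, ℂ) → Prop} (h_zero : P 0)
    (h_add : ∀ f g, P f → P g → P (f + g))
    (h_bis : ∀ X, IsOpenBisection X → ∀ f : C_c(G, ℂ), tsupport f ⊆ X → P f)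
    (f : C_c(G, ℂ)) : P f := by
  choose X hX hmem using exists_isOpenBisection (G := G)
  obtain ⟨t, ht⟩ := f.hasCompactSupport.isCompact.elim_finite_subcover X (fun a => (hX a).1)
    (fun a _ => mem_iUnion.2 ⟨a, hmem a⟩)
  obtain ⟨n, ⟨e⟩⟩ : ∃ n, Nonempty (t ≃ Fin n) := ⟨_, ⟨Fintype.equivFin t⟩⟩
  obtain ⟨p, hp, hsum, -, -⟩ := exists_continuous_sum_one_of_isOpen_isCompact
    (s := fun i : Fin n => X (e.symm i)) (fun i => (hX _).1) f.hasCompactSupport.isCompact (by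
      intro a ha
      obtain ⟨b, hb, hab⟩ := mem_iUnion₂.1 (ht ha)
      exact mem_iUnion.2 ⟨e ⟨b, hb⟩, by simpa using hab⟩)
  let F : Fin n → C_c(G, ℂ) := fun i =>
    { toFun := fun a => (p i a : ℂ) * f a
      continuous_toFun := by fun_prop
      hasCompactSupport' := f.hasCompactSupport.mul_left }
  have hF : f = ∑ i, F i := by
    ext a
    rw [CompactlySupportedContinuousMap.sum_apply]
    change f a = ∑ i, (p i a : ℂ) * f a
    rw [← Finset.sum_mul]
    by_cases ha : a ∈ tsupport f
    · have h1 := hsum ha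
      simp only [Finset.sum_apply, Pi.one_apply] at h1
      rw [← Complex.ofReal_sum, h1]; simp
    · simp [image_eq_zero_of_notMem_tsupport ha]
  rw [hF]
  refine Finset.sum_induction F P h_add h_zero fun i _ => h_bis _ (hX (e.symm i)) _ ?_
  refine subset_trans ?_ (hp i)
  refine closure_mono ?_
  intro a ha hpa
  apply ha
  change (p i a : ℂ) * f a = 0
  rw [hpa]; simp

end Topology

section Convolution

variable {G : Type*} [TopologicalSpace G] [AlgGroupoid G] [EtaleGroupoid G]

/-- The convolution `(f × g)(c) = ∑_{a b = c} f(a) g(b)`; the sums that occur below have only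
finitely many non-zero terms. -/
noncomputable def conv {G : Type*} [AlgGroupoid G] (f g : G → ℂ) (c : G) : ℂ :=
  ∑ᶠ p : {p : G × G // p ∈ composable G ∧ gmul p.1 p.2 = c}, f p.1.1 * g p.1.2

theorem conv_eq_finsum {G : Type*} [AlgGroupoid G] (f g : G → ℂ) (c : G) :
    conv f g c = ∑ᶠ a ∈ {a | rg a = rg c}, f a * g (gmul (ginv a) c) := by
  rw [← finsum_set_coe_eq_finsum_mem]
  refine finsum_eq_of_bijective
    (fun p => ⟨p.1.1, by
      have h := p.2.2 ▸ rg_gmul (composable_iff.1 p.2.1)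
      exact h.symm⟩) ⟨?_, ?_⟩ ?_
  · rintro ⟨⟨a, b⟩, h, k⟩ ⟨⟨a', b'⟩, h', k'⟩ hab
    simp only [Subtype.mk.injEq] at hab
    subst hab
    have h1 := ginv_gmul_eq (composable_iff.1 h) k
    have h2 := ginv_gmul_eq (composable_iff.1 h') k'
    have h3 : b = b' := h1.symm.trans h2
    subst h3
    rfl
  · rintro ⟨a, ha⟩
    refine ⟨⟨(a, gmul (ginv a) c), ?_, gmul_ginv_gmul ha⟩, rfl⟩
    rw [composable_iff, rg_gmul (by rw [sr_ginv]; exact ha), rg_ginv]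
  · rintro ⟨⟨a, b⟩, h, k⟩
    rw [ginv_gmul_eq (composable_iff.1 h) k]

theorem conv_eq_sum {G : Type*} [AlgGroupoid G] (f g : G → ℂ) (c : G) (F : Finset G)
    (hF : ∀ a ∈ F, rg a = rg c) (hF' : ∀ a, rg a = rg c → f a ≠ 0 → a ∈ F) :
    conv f g c = ∑ a ∈ F, f a * g (gmul (ginv a) c) := by
  rw [conv_eq_finsum]
  refine finsum_mem_eq_sum_of_subset _ ?_ hF
  rintro a ⟨h, k⟩
  exact hF' a h (left_ne_zero_of_mul k)

theorem conv_bisection {G : Type*} [TopologicalSpace G] [AlgGroupoid G] {X : Set G}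
    (hX : IsOpenBisection X) {f : G → ℂ} (hf : ∀ a ∉ X, f a = 0) (g : G → ℂ) {a c : G}
    (ha : a ∈ X) (hac : rg a = rg c) : conv f g c = f a * g (gmul (ginv a) c) := by
  rw [conv_eq_sum f g c {a} (by simpa using hac) ?_, Finset.sum_singleton]
  intro b hb hfb
  rw [Finset.mem_singleton]
  exact hX.injOn_rg (by_contra fun h => hfb (hf b h)) ha (hb.trans hac.symm)

theorem conv_eq_zero {G : Type*} [AlgGroupoid G] {f : G → ℂ} (g : G → ℂ) {c : G}
    (h : ∀ a, rg a = rg c → f a = 0) : conv f g c = 0 := by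
  rw [conv_eq_sum f g c ∅ (by simp) (fun a ha hfa => absurd (h a ha) hfa), Finset.sum_empty]

theorem exists_fibre (f : C_c(G, ℂ)) (u : G) :
    ∃ F : Finset G, (∀ a ∈ F, rg a = u) ∧ ∀ a, rg a = u → f a ≠ 0 → a ∈ F := by
  classical
  suffices h : {a | rg a = u ∧ f a ≠ 0}.Finite by
    exact ⟨h.toFinset, fun a ha => ((h.mem_toFinset).1 ha).1, fun a h1 h2 =>
      h.mem_toFinset.2 ⟨h1, h2⟩⟩
  refine cc_induction (P := fun f => {a | rg a = u ∧ f a ≠ 0}.Finite) ?_ ?_ ?_ f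
  · simp
  · intro f g hf hg
    refine (hf.union hg).subset ?_
    rintro a ⟨h, k⟩
    by_cases hfa : f a = 0
    · exact Or.inr ⟨h, fun hga => k (by simp [hfa, hga])⟩
    · exact Or.inl ⟨h, hfa⟩
  · intro X hX f hf
    refine Set.Subsingleton.finite ?_
    rintro a ⟨h, k⟩ b ⟨h', k'⟩
    exact hX.injOn_rg (hf (subset_tsupport f k)) (hf (subset_tsupport f k')) (h.trans h'.symm)

theorem conv_add_left (f f' : C_c(G, ℂ)) (g : G → ℂ) (c : G) :
    conv (⇑(f + f')) g c = conv f g c + conv f' g c := by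
  classical
  obtain ⟨F, hF, hF'⟩ := exists_fibre f (rg c)
  obtain ⟨K, hK, hK'⟩ := exists_fibre f' (rg c)
  have h : ∀ a ∈ F ∪ K, rg a = rg c := fun a ha =>
    (Finset.mem_union.1 ha).elim (hF a) (hK a)
  rw [conv_eq_sum _ g c (F ∪ K) h, conv_eq_sum f g c (F ∪ K) h, conv_eq_sum f' g c (F ∪ K) h,
    ← Finset.sum_add_distrib]
  · exact Finset.sum_congr rfl fun a _ => by simp [add_mul]
  · exact fun a h1 h2 => Finset.mem_union_right _ (hK' a h1 h2)
  · exact fun a h1 h2 => Finset.mem_union_left _ (hF' a h1 h2)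
  · intro a h1 h2
    by_cases hfa : f a = 0
    · exact Finset.mem_union_right _ (hK' a h1 fun h => h2 (by simp [hfa, h]))
    · exact Finset.mem_union_left _ (hF' a h1 hfa)

theorem conv_add_right (f : C_c(G, ℂ)) (g g' : G → ℂ) (c : G) :
    conv f (g + g') c = conv f g c + conv f g' c := by
  obtain ⟨F, hF, hF'⟩ := exists_fibre f (rg c)
  rw [conv_eq_sum _ _ c F hF hF', conv_eq_sum _ _ c F hF hF', conv_eq_sum _ _ c F hF hF',
    ← Finset.sum_add_distrib]
  exact Finset.sum_congr rfl fun a _ => by simp [mul_add]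

theorem conv_smul_right (f : C_c(G, ℂ)) (z : ℂ) (g : G → ℂ) (c : G) :
    conv f (z • g) c = z * conv f g c := by
  obtain ⟨F, hF, hF'⟩ := exists_fibre f (rg c)
  rw [conv_eq_sum _ _ c F hF hF', conv_eq_sum _ _ c F hF hF', Finset.mul_sum]
  exact Finset.sum_congr rfl fun a _ => by simp only [Pi.smul_apply, smul_eq_mul]; ring

theorem conv_smul_left (f : C_c(G, ℂ)) (z : ℂ) (g : G → ℂ) (c : G) :
    conv (⇑(z • f)) g c = z * conv f g c := by
  obtain ⟨F, hF, hF'⟩ := exists_fibre f (rg c)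
  rw [conv_eq_sum _ _ c F hF hF', conv_eq_sum _ _ c F hF, Finset.mul_sum]
  · exact Finset.sum_congr rfl fun a _ => by
      simp only [CompactlySupportedContinuousMap.smul_apply, smul_eq_mul]; ring
  · exact fun a h1 h2 => hF' a h1 fun h => h2 (by simp [h])

theorem continuous_conv (f : C_c(G, ℂ)) {g : G → ℂ} (hg : Continuous g) :
    Continuous (conv f g) := by
  refine cc_induction (P := fun f => Continuous (conv f g)) ?_ ?_ ?_ f
  · have : conv (⇑(0 : C_c(G, ℂ))) g = fun _ => 0 := by
      ext c; exact conv_eq_zero g (by simp)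
    rw [this]; exact continuous_const
  · intro f f' hf hf'
    have : conv (⇑(f + f')) g = fun c => conv f g c + conv f' g c := by
      ext c; exact conv_add_left f f' g c
    rw [this]; exact hf.add hf'
  · intro X hX f hf
    have hf0 : ∀ a ∉ X, f a = 0 := fun a ha =>
      image_eq_zero_of_notMem_tsupport fun h => ha (hf h)
    rw [continuous_iff_continuousAt]
    intro c
    by_cases hc : rg c ∈ rg '' X
    · obtain ⟨a, ha, hac⟩ := hc
      have : Nonempty X := ⟨⟨a, ha⟩⟩
      let e := hX.2.1.toOpenPartialHomeomorph
      have hV : IsOpen (rg ⁻¹' (rg '' X) : Set G) := by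
        have := hX.2.1.isOpen_range
        rw [Set.range_domRestrict] at this
        exact this.preimage continuous_rg
      let σ : G → G := fun c => (e.symm (rg c) : G)
      have hσ : ∀ c ∈ (rg ⁻¹' (rg '' X) : Set G), σ c ∈ X ∧ rg (σ c) = rg c := by
        intro c hc
        refine ⟨(e.symm (rg c)).2, ?_⟩
        have : rg c ∈ e.target := by
          change rg c ∈ (hX.2.1.toOpenPartialHomeomorph).target
          rw [IsOpenEmbedding.toOpenPartialHomeomorph_target, Set.range_domRestrict]
          exact hc
        exact e.right_inv this
      have hσc : ContinuousOn σ (rg ⁻¹' (rg '' X)) := by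
        refine continuous_subtype_val.comp_continuousOn ?_
        refine e.symm.continuousOn.comp continuous_rg.continuousOn ?_
        intro c hc
        change rg c ∈ (hX.2.1.toOpenPartialHomeomorph).target
        rw [IsOpenEmbedding.toOpenPartialHomeomorph_target, Set.range_domRestrict]
        exact hc
      have hcV : c ∈ (rg ⁻¹' (rg '' X) : Set G) := ⟨a, ha, hac⟩
      have hcont : ContinuousOn (fun c => f (σ c) * g (gmul (ginv (σ c)) c))
          (rg ⁻¹' (rg '' X)) := by
        refine (f.continuous.comp_continuousOn hσc).mul (hg.comp_continuousOn ?_)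
        refine EtaleGroupoid.continuousOn_gmul.comp (f := fun c => (ginv (σ c), c))
          ((EtaleGroupoid.continuous_ginv.comp_continuousOn hσc).prodMk continuousOn_id) ?_
        intro c hc
        exact composable_iff.2 (by rw [sr_ginv]; exact (hσ c hc).2)
      refine (hcont.continuousAt (hV.mem_nhds hcV)).congr ?_
      filter_upwards [hV.mem_nhds hcV] with d hd
      exact (conv_bisection hX hf0 g (hσ d hd).1 (hσ d hd).2).symm
    · have hK : IsClosed (rg '' tsupport f) :=
        (f.hasCompactSupport.isCompact.image continuous_rg).isClosed
      have hc' : c ∈ (rg ⁻¹' (rg '' tsupport f)ᶜ : Set G) := fun h =>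
        hc (image_mono hf h)
      have hz : ∀ d ∈ (rg ⁻¹' (rg '' tsupport f)ᶜ : Set G), 0 = conv f g d := by
        intro d hd
        refine (conv_eq_zero g fun a had => ?_).symm
        exact image_eq_zero_of_notMem_tsupport fun h => hd ⟨a, h, had⟩
      refine (continuousAt_const (y := (0 : ℂ))).congr ?_
      filter_upwards [(hK.isOpen_compl.preimage continuous_rg).mem_nhds hc'] with d hd
      exact hz d hd

theorem conv_hasCompactSupport (f g : C_c(G, ℂ)) : HasCompactSupport (conv f g) := by
  have hK : IsCompact ((tsupport f ×ˢ tsupport g) ∩ composable G) :=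
    (f.hasCompactSupport.isCompact.prod g.hasCompactSupport.isCompact).inter_right
      isClosed_composable
  refine HasCompactSupport.intro
    (hK.image_of_continuousOn (EtaleGroupoid.continuousOn_gmul.mono inter_subset_right)) ?_
  intro c hc
  rw [conv]
  refine finsum_eq_zero_of_forall_eq_zero ?_
  rintro ⟨⟨a, b⟩, h, k⟩
  by_contra h0
  refine hc ⟨(a, b), ⟨⟨subset_tsupport f (left_ne_zero_of_mul h0),
    subset_tsupport g (right_ne_zero_of_mul h0)⟩, h⟩, k⟩

/-- The convolution product on `C_c(G)`. -/
noncomputable def ccConv (f g : C_c(G, ℂ)) : C_c(G, ℂ) where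
  toFun := conv f g
  continuous_toFun := continuous_conv f g.continuous
  hasCompactSupport' := conv_hasCompactSupport f g

/-- The involution `f^*(a) = conj (f (a⁻¹))` on `C_c(G)`. -/
noncomputable def ccStar (f : C_c(G, ℂ)) : C_c(G, ℂ) where
  toFun := fun a => star (f (ginv a))
  continuous_toFun := (f.continuous.comp EtaleGroupoid.continuous_ginv).star
  hasCompactSupport' := by
    refine HasCompactSupport.intro
      (f.hasCompactSupport.isCompact.image EtaleGroupoid.continuous_ginv) ?_
    intro a ha
    rw [image_eq_zero_of_notMem_tsupport (f := f) fun h => ha ⟨_, h, ginv_ginv a⟩, star_zero]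

end Convolution

section RegularRepresentation

variable {G : Type*} [TopologicalSpace G] [AlgGroupoid G] [EtaleGroupoid G]

/-- The Hilbert space `ℓ²(G)`, which is the direct sum over the units `u` of the spaces
`ℓ²(s⁻¹(u))`. -/
abbrev L2 (G : Type*) : Type _ := lp (fun _ : G => ℂ) 2

/-- Bounded operators on `ℓ²(G)`. -/
abbrev BL2 (G : Type*) : Type _ := L2 G →L[ℂ] L2 G

theorem exists_conv_bound (f : C_c(G, ℂ)) :
    ∃ C : ℝ, ∀ x : L2 G, ∃ y : L2 G, (y : G → ℂ) = conv f x ∧ ‖y‖ ≤ C * ‖x‖ := by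
  refine cc_induction (P := fun f => ∃ C : ℝ, ∀ x : L2 G, ∃ y : L2 G,
    (y : G → ℂ) = conv f x ∧ ‖y‖ ≤ C * ‖x‖) ?_ ?_ ?_ f
  · refine ⟨0, fun x => ⟨0, ?_, by simp⟩⟩
    ext c
    rw [conv_eq_zero _ (by simp)]; rfl
  · rintro f g ⟨C, hC⟩ ⟨D, hD⟩
    refine ⟨C + D, fun x => ?_⟩
    obtain ⟨y, hy, hy'⟩ := hC x
    obtain ⟨z, hz, hz'⟩ := hD x
    refine ⟨y + z, ?_, ?_⟩
    · ext c
      rw [conv_add_left, ← hy, ← hz]; rfl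
    · rw [add_mul]; exact (norm_add_le y z).trans (add_le_add hy' hz')
  · classical
    intro X hX f hf
    have hf0 : ∀ a ∉ X, f a = 0 := fun a ha =>
      image_eq_zero_of_notMem_tsupport fun h => ha (hf h)
    obtain ⟨M, hM⟩ := f.continuous.bounded_above_of_compact_support f.hasCompactSupport
    have hM0 : 0 ≤ max M 0 := le_max_right _ _
    have hM' : ∀ a, ‖f a‖ ≤ max M 0 := fun a => (hM a).trans (le_max_left _ _)
    have key : ∀ x : L2 G, ∀ t : Finset G,
        ∑ c ∈ t, ‖conv f x c‖ ^ 2 ≤ (max M 0 * ‖x‖) ^ 2 := by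
      intro x t
      have hch : ∀ c : G, ∃ a : G, rg c ∈ rg '' X → a ∈ X ∧ rg a = rg c := by
        intro c
        by_cases h : rg c ∈ rg '' X
        · obtain ⟨a, ha, hac⟩ := h
          exact ⟨a, fun _ => ⟨ha, hac⟩⟩
        · exact ⟨c, fun h' => absurd h' h⟩
      choose σ hσ using hch
      let t' := t.filter (fun c => rg c ∈ rg '' X)
      have h1 : ∑ c ∈ t, ‖conv f x c‖ ^ 2 = ∑ c ∈ t', ‖conv f x c‖ ^ 2 := by
        refine (Finset.sum_filter_of_ne ?_).symm
        intro c _ hc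
        by_contra h
        refine hc ?_
        rw [conv_eq_zero _ fun a ha => hf0 a fun haX => h ⟨a, haX, ha⟩]; simp
      have h2 : ∀ c ∈ t', ‖conv f x c‖ ^ 2 ≤
          (max M 0) ^ 2 * ‖x (gmul (ginv (σ c)) c)‖ ^ 2 := by
        intro c hc
        obtain ⟨hs, hs'⟩ := hσ c (Finset.mem_filter.1 hc).2
        rw [conv_bisection hX hf0 _ hs hs', norm_mul, mul_pow]
        gcongr
        exact hM' _
      have hinj : Set.InjOn (fun c => gmul (ginv (σ c)) c) (t' : Set G) := by
        intro c hc d hd hcd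
        obtain ⟨hs, hs'⟩ := hσ c (Finset.mem_filter.1 hc).2
        obtain ⟨ks, ks'⟩ := hσ d (Finset.mem_filter.1 hd).2
        have e1 : rg (gmul (ginv (σ c)) c) = sr (σ c) := by
          rw [rg_gmul (by rw [sr_ginv, hs']), rg_ginv]
        have e2 : rg (gmul (ginv (σ d)) d) = sr (σ d) := by
          rw [rg_gmul (by rw [sr_ginv, ks']), rg_ginv]
        have e3 : σ c = σ d := hX.injOn_sr hs ks (by
          rw [← e1, ← e2]; exact congrArg rg hcd)
        rw [← gmul_ginv_gmul hs', ← gmul_ginv_gmul ks']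
        simp only at hcd
        rw [hcd, e3]
      rw [h1]
      refine (Finset.sum_le_sum h2).trans ?_
      rw [← Finset.mul_sum, mul_pow]
      gcongr
      rw [← Finset.sum_image (f := fun b => ‖x b‖ ^ 2) hinj]
      have := lp.sum_rpow_le_norm_rpow (p := 2) (by norm_num) x
        (t'.image (fun c => gmul (ginv (σ c)) c))
      simpa using this
    refine ⟨max M 0, fun x => ?_⟩
    have hmem : Memℓp (conv f x) 2 := memℓp_gen' (C := (max M 0 * ‖x‖) ^ 2) fun t => by
      simpa using key x t
    refine ⟨⟨conv f x, hmem⟩, rfl, ?_⟩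
    refine lp.norm_le_of_forall_sum_le (by norm_num) (by positivity) fun t => ?_
    simpa using key x t

theorem memLp_conv (f : C_c(G, ℂ)) (x : L2 G) : Memℓp (conv f x) 2 := by
  obtain ⟨C, hC⟩ := exists_conv_bound f
  obtain ⟨y, hy, -⟩ := hC x
  rw [← hy]
  exact lp.memℓp y

/-- The left regular representation: `f` acts on `ℓ²(G)` by left convolution. -/
noncomputable def regRep (f : C_c(G, ℂ)) : BL2 G :=
  LinearMap.mkContinuousOfExistsBound
    { toFun := fun x => (⟨conv f x, memLp_conv f x⟩ : L2 G)
      map_add' := fun x y => by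
        apply lp.ext
        ext c
        exact conv_add_right f x y c
      map_smul' := fun z x => by
        apply lp.ext
        ext c
        exact conv_smul_right f z x c }
    (by
      obtain ⟨C, hC⟩ := exists_conv_bound f
      refine ⟨C, fun x => ?_⟩
      obtain ⟨y, hy, hy'⟩ := hC x
      have : (⟨conv f x, memLp_conv f x⟩ : L2 G) = y := lp.ext hy.symm
      change ‖(⟨conv f x, memLp_conv f x⟩ : L2 G)‖ ≤ _
      rw [this]
      exact hy')

theorem regRep_apply (f : C_c(G, ℂ)) (x : L2 G) (c : G) :
    regRep f x c = conv f x c := rfl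

open Classical in
/-- Matrix coefficient of an operator on `ℓ²(G)` at the canonical basis vectors. -/
noncomputable def coeff {G : Type*} (T : BL2 G) (c b : G) : ℂ := T (lp.single 2 b 1) c

theorem coeff_ext {G : Type*} {S T : BL2 G} (h : ∀ c b, coeff S c b = coeff T c b) : S = T := by
  classical
  refine lp.ext_continuousLinearMap (by norm_num) fun b => ?_
  refine ContinuousLinearMap.ext_ring ?_
  apply lp.ext
  ext c
  exact h c b

theorem norm_coeff_le {G : Type*} (T : BL2 G) (c b : G) : ‖coeff T c b‖ ≤ ‖T‖ := by
  classical
  calc ‖coeff T c b‖ ≤ ‖T (lp.single 2 b 1)‖ := lp.norm_apply_le_norm (by norm_num) _ c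
    _ ≤ ‖T‖ * ‖(lp.single 2 b 1 : L2 G)‖ := T.le_opNorm _
    _ = ‖T‖ := by rw [lp.norm_single (by norm_num)]; simp

theorem coeff_star {G : Type*} (T : BL2 G) (c b : G) :
    coeff (star T) c b = star (coeff T b c) := by
  classical
  have h1 := lp.inner_single_left (𝕜 := ℂ) c (1 : ℂ) (star T (lp.single 2 b 1))
  have h2 := lp.inner_single_right (𝕜 := ℂ) b (1 : ℂ) (T (lp.single 2 c 1))
  rw [ContinuousLinearMap.star_eq_adjoint, ContinuousLinearMap.adjoint_inner_right] at h1
  rw [h1] at h2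
  simpa [coeff, ContinuousLinearMap.star_eq_adjoint] using h2

theorem coeff_regRep (f : C_c(G, ℂ)) (c b : G) [Decidable (sr c = sr b)] :
    coeff (regRep f) c b = if sr c = sr b then f (gmul c (ginv b)) else 0 := by
  classical
  rw [coeff, regRep_apply, lp.coeFn_single]
  split_ifs with h
  · obtain ⟨F, hF, hF'⟩ := exists_fibre f (rg c)
    have hcb : rg (gmul c (ginv b)) = rg c := rg_gmul (by rw [h, rg_ginv])
    have hmul : ∀ a, rg a = rg c → gmul (ginv a) c = b → a = gmul c (ginv b) := by
      intro a ha hab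
      have h1 := gmul_ginv_gmul ha
      rw [hab] at h1
      rw [← h1]
      refine (gmul_ginv (composable_iff.2 ?_)).symm
      rw [← hab, rg_gmul (by rw [sr_ginv, ha]), rg_ginv]
    have hmul' : gmul (ginv (gmul c (ginv b))) c = b := by
      refine ginv_gmul_eq (by rw [sr_gmul (by rw [h, rg_ginv]), sr_ginv]) ?_
      have := gmul_ginv (a := c) (b := ginv b) (composable_iff.2 (by rw [h, rg_ginv]))
      rwa [ginv_ginv] at this
    rw [conv_eq_sum f _ c (insert (gmul c (ginv b)) F) (by
      intro a ha
      rcases Finset.mem_insert.1 ha with rfl | ha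
      · exact hcb
      · exact hF a ha) (fun a h1 h2 => Finset.mem_insert_of_mem (hF' a h1 h2)),
      Finset.sum_eq_single_of_mem (gmul c (ginv b)) (Finset.mem_insert_self _ _)]
    · rw [hmul']; simp
    · intro a ha hne
      have har : rg a = rg c := by
        rcases Finset.mem_insert.1 ha with rfl | ha
        · exact hcb
        · exact hF a ha
      rw [Pi.single_eq_of_ne fun hab => hne (hmul a har hab), mul_zero]
  · obtain ⟨F, hF, hF'⟩ := exists_fibre f (rg c)
    rw [conv_eq_sum f _ c F hF hF']
    refine Finset.sum_eq_zero fun a ha => ?_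
    rw [Pi.single_eq_of_ne, mul_zero]
    intro hab
    apply h
    rw [← hab, sr_gmul (by rw [sr_ginv, hF a ha])]

theorem regRep_add (f g : C_c(G, ℂ)) : regRep (f + g) = regRep f + regRep g := by
  ext x c
  exact conv_add_left f g x c

theorem regRep_smul (z : ℂ) (f : C_c(G, ℂ)) : regRep (z • f) = z • regRep f := by
  ext x c
  exact conv_smul_left f z x c

theorem regRep_star (f : C_c(G, ℂ)) : regRep (ccStar f) = star (regRep f) := by
  classical
  refine coeff_ext fun c b => ?_
  rw [coeff_star, coeff_regRep, coeff_regRep]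
  by_cases h : sr c = sr b
  · rw [if_pos h, if_pos h.symm]
    change star (f (ginv (gmul c (ginv b)))) = _
    congr 2
    have h1 : gmul (gmul c (ginv b)) b = c := by
      have := gmul_ginv (a := c) (b := ginv b) (composable_iff.2 (by rw [h, rg_ginv]))
      rwa [ginv_ginv] at this
    have hs : sr (gmul c (ginv b)) = rg b := by
      rw [sr_gmul (by rw [h, rg_ginv]), sr_ginv]
    have h2 : gmul (ginv (gmul c (ginv b))) c = b := ginv_gmul_eq hs h1
    have h3 := gmul_ginv (a := ginv (gmul c (ginv b))) (b := c) (composable_iff.2 (by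
      rw [sr_ginv, rg_gmul (by rw [h, rg_ginv])]))
    rw [h2] at h3
    exact h3.symm
  · rw [if_neg h, if_neg fun h' => h h'.symm, star_zero]

theorem regRep_conv (f g : C_c(G, ℂ)) : regRep (ccConv f g) = regRep f * regRep g := by
  classical
  refine coeff_ext fun c b => ?_
  have hR : coeff (regRep f * regRep g) c b =
      conv f (fun a => coeff (regRep g) a b) c := by
    change regRep f (regRep g (lp.single 2 b 1)) c = _
    rw [regRep_apply]; rfl
  obtain ⟨F, hF, hF'⟩ := exists_fibre f (rg c)
  rw [hR, coeff_regRep, conv_eq_sum f _ c F hF hF']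
  split_ifs with h
  · have hcb : rg (gmul c (ginv b)) = rg c := rg_gmul (by rw [h, rg_ginv])
    change conv f g (gmul c (ginv b)) = _
    rw [conv_eq_sum f g (gmul c (ginv b)) F (by rw [hcb]; exact hF) (by rw [hcb]; exact hF')]
    refine Finset.sum_congr rfl fun a ha => ?_
    rw [coeff_regRep, if_pos (by rw [sr_gmul (by rw [sr_ginv, hF a ha]), h])]
    congr 2
    exact (gassoc (composable_iff.2 (by rw [sr_ginv, hF a ha]))
      (composable_iff.2 (by rw [h, rg_ginv]))).2.2
  · refine (Finset.sum_eq_zero fun a ha => ?_).symm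
    rw [coeff_regRep, if_neg, mul_zero]
    rwa [sr_gmul (by rw [sr_ginv, hF a ha])]

/-- The image of the convolution algebra `C_c(G)` under the regular representation. -/
noncomputable def regRange (G : Type*) [TopologicalSpace G] [AlgGroupoid G] [EtaleGroupoid G] :
    NonUnitalStarSubalgebra ℂ (BL2 G) where
  carrier := Set.range regRep
  add_mem' := by
    rintro _ _ ⟨f, rfl⟩ ⟨g, rfl⟩
    exact ⟨f + g, regRep_add f g⟩
  zero_mem' := ⟨0, by simpa using regRep_smul (G := G) 0 0⟩
  mul_mem' := by
    rintro _ _ ⟨f, rfl⟩ ⟨g, rfl⟩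
    exact ⟨ccConv f g, regRep_conv f g⟩
  smul_mem' := by
    rintro z _ ⟨f, rfl⟩
    exact ⟨z • f, regRep_smul z f⟩
  star_mem' := by
    rintro _ ⟨f, rfl⟩
    exact ⟨ccStar f, regRep_star f⟩

/-- The reduced groupoid `C^*`-algebra: the completion of `C_c(G)` in the norm of the regular
representation, realised as a norm-closed algebra of operators on `ℓ²(G)`. -/
noncomputable def reducedCStar (G : Type*) [TopologicalSpace G] [AlgGroupoid G]
    [EtaleGroupoid G] : NonUnitalStarSubalgebra ℂ (BL2 G) :=
  (regRange G).topologicalClosure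

/-- The inclusion `C_c(G) ⊂ C^*_red(G)`. -/
noncomputable def ofCc (f : C_c(G, ℂ)) : reducedCStar G :=
  ⟨regRep f, (regRange G).le_topologicalClosure ⟨f, rfl⟩⟩

end RegularRepresentation

section Inclusion

variable {G : Type*} [TopologicalSpace G] [AlgGroupoid G] [EtaleGroupoid G]

instance : IsClosed (reducedCStar G : Set (BL2 G)) :=
  (regRange G).isClosed_topologicalClosure

theorem memLp_diag {G : Type*} [TopologicalSpace G] [AlgGroupoid G] (h : C₀(units G, ℂ)) (x : L2 G) :
    Memℓp (fun c => h (rgU c) * x c) 2 := by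
  refine ((lp.memℓp x).const_smul (‖h‖ : ℂ)).mono' fun c => ?_
  simp only [Pi.smul_apply, norm_mul, smul_eq_mul]
  gcongr
  simpa using h.toBCF.norm_coe_le_norm (rgU c)

theorem norm_diag_le {G : Type*} {a : G → ℂ} {C : ℝ} (hC : 0 ≤ C) (ha : ∀ c, ‖a c‖ ≤ C) (x y : L2 G)
    (hy : ∀ c, y c = a c * x c) : ‖y‖ ≤ C * ‖x‖ := by
  refine lp.norm_le_of_forall_sum_le (by norm_num) (by positivity) fun t => ?_
  calc ∑ c ∈ t, ‖y c‖ ^ (2 : ℝ≥0∞).toReal ≤ ∑ c ∈ t, C ^ 2 * ‖x c‖ ^ 2 := by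
        refine Finset.sum_le_sum fun c _ => ?_
        rw [hy, norm_mul, ← mul_pow]
        simp only [ENNReal.toReal_ofNat, Real.rpow_ofNat]
        gcongr
        exact ha c
    _ ≤ (C * ‖x‖) ^ (2 : ℝ≥0∞).toReal := by
        rw [← Finset.mul_sum]
        have := lp.sum_rpow_le_norm_rpow (p := 2) (by norm_num) x t
        simp only [ENNReal.toReal_ofNat, Real.rpow_ofNat] at this ⊢
        rw [mul_pow]
        gcongr

/-- The operator on `ℓ²(G)` of multiplication by `h ∘ r`, for `h ∈ C₀(G⁰)`. -/
noncomputable def diagOp (h : C₀(units G, ℂ)) : BL2 G :=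
  LinearMap.mkContinuous
    { toFun := fun x => (⟨fun c => h (rgU c) * x c, memLp_diag h x⟩ : L2 G)
      map_add' := fun x y => by
        apply lp.ext
        ext c
        exact mul_add (h (rgU c)) (x c) (y c)
      map_smul' := fun z x => by
        apply lp.ext
        ext c
        exact mul_left_comm (h (rgU c)) z (x c) }
    ‖h‖ fun x => norm_diag_le (norm_nonneg h)
      (fun c => h.toBCF.norm_coe_le_norm (rgU c)) x _ fun _ => rfl

theorem diagOp_apply {G : Type*} [TopologicalSpace G] [AlgGroupoid G]
    (h : C₀(units G, ℂ)) (x : L2 G) (c : G) :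
    diagOp h x c = h (rgU c) * x c := rfl

/-- A function in `C_c(G)` vanishing off the unit space acts by multiplication. -/
theorem regRep_of_units (f : C_c(G, ℂ)) (hf : ∀ a ∉ units G, f a = 0) (x : L2 G) (c : G) :
    regRep f x c = f (rg c) * x c := by
  rw [regRep_apply, conv_eq_sum f x c {rg c} (by simpa using rg_rg c) ?_, Finset.sum_singleton,
    ginv_of_mem_units (rg_mem_units c), rg_gmul_self]
  intro a ha hfa
  have : a ∈ units G := by_contra fun h => hfa (hf a h)
  rw [Finset.mem_singleton, ← ha, rg_of_mem_units this]

theorem diagOp_mem (h : C₀(units G, ℂ)) : diagOp h ∈ reducedCStar G := by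
  change diagOp h ∈ closure (Set.range regRep)
  rw [Metric.mem_closure_iff]
  intro ε hε
  have hlim : {u | ‖h u‖ < ε / 2} ∈ cocompact (units G) := by
    have := (zero_at_infty h).norm
    rw [norm_zero] at this
    exact this (Iio_mem_nhds (half_pos hε))
  obtain ⟨K, hK, hKh⟩ := mem_cocompact.1 hlim
  obtain ⟨χ, hχ1, hχ0, hχc, hχ⟩ := exists_continuous_one_zero_of_isCompact
    (hK.image continuous_subtype_val) (isOpen_units (G := G)).isClosed_compl (by
      rw [Set.disjoint_compl_right_iff_subset]
      rintro _ ⟨u, -, rfl⟩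
      exact u.2)
  let f : C_c(G, ℂ) :=
    { toFun := fun c => (χ c : ℂ) * h (rgU c)
      continuous_toFun := (Complex.continuous_ofReal.comp χ.continuous).mul
        ((map_continuous h).comp continuous_rgU)
      hasCompactSupport' := by
        have h1 : HasCompactSupport (fun c => (χ c : ℂ)) :=
          hχc.comp_left (g := fun x : ℝ => (x : ℂ)) Complex.ofReal_zero
        exact h1.mul_right }
  have hf : ∀ a ∉ units G, f a = 0 := by
    intro a ha
    change (χ a : ℂ) * _ = 0
    rw [hχ0 ha]; simp
  refine ⟨regRep f, ⟨f, rfl⟩, ?_⟩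
  rw [dist_eq_norm]
  refine lt_of_le_of_lt (ContinuousLinearMap.opNorm_le_bound _ (half_pos hε).le fun x => ?_)
    (half_lt_self hε)
  refine norm_diag_le (a := fun c => h (rgU c) - f (rg c)) (half_pos hε).le ?_ x _ ?_
  · intro c
    have e1 : f (rg c) = (χ (rg c) : ℂ) * h (rgU c) := by
      change (χ (rg c) : ℂ) * h (rgU (rg c)) = _
      congr 2
      exact Subtype.ext (rg_rg c)
    rw [e1]
    by_cases hc : rgU c ∈ K
    · have h1 : χ (rg c) = 1 := hχ1 ⟨rgU c, hc, rfl⟩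
      rw [h1]
      simpa using (half_pos hε).le
    · have h1 : ‖h (rgU c)‖ < ε / 2 := hKh hc
      have h2 := hχ (rg c)
      calc ‖h (rgU c) - (χ (rg c) : ℂ) * h (rgU c)‖
          = ‖((1 - χ (rg c) : ℝ) : ℂ)‖ * ‖h (rgU c)‖ := by
            rw [← norm_mul]; push_cast; ring_nf
        _ ≤ 1 * (ε / 2) := by
            rw [Complex.norm_real, Real.norm_of_nonneg (by linarith [h2.2])]
            exact mul_le_mul (by linarith [h2.1]) h1.le (norm_nonneg _) zero_le_one
        _ = ε / 2 := one_mul _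
  · intro c
    change diagOp h x c - regRep f x c = _
    rw [regRep_of_units f hf, diagOp_apply, sub_mul]

theorem coeff_diagOp {G : Type*} [TopologicalSpace G] [AlgGroupoid G] (h : C₀(units G, ℂ))
    (c b : G) [Decidable (c = b)] :
    coeff (diagOp h) c b = if c = b then h (rgU c) else 0 := by
  classical
  rw [coeff, diagOp_apply, lp.single_apply]
  split_ifs with hcb
  · rw [hcb, Pi.single_eq_same, mul_one]
  · rw [Pi.single_eq_of_ne hcb, mul_zero]

/-- The inclusion `C₀(G⁰) ⊂ C^*_red(G)`. -/
noncomputable def incl (G : Type*) [TopologicalSpace G] [AlgGroupoid G] [EtaleGroupoid G] :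
    C₀(units G, ℂ) →⋆ₙₐ[ℂ] reducedCStar G where
  toFun h := ⟨diagOp h, diagOp_mem h⟩
  map_smul' z h := by
    apply Subtype.ext
    ext x c
    exact mul_assoc z (h (rgU c)) (x c)
  map_zero' := by
    apply Subtype.ext
    ext x c
    exact zero_mul (x c)
  map_add' h k := by
    apply Subtype.ext
    ext x c
    exact add_mul (h (rgU c)) (k (rgU c)) (x c)
  map_mul' h k := by
    apply Subtype.ext
    ext x c
    exact mul_assoc (h (rgU c)) (k (rgU c)) (x c)
  map_star' h := by
    classical
    apply Subtype.ext
    refine coeff_ext fun c b => ?_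
    change coeff (diagOp (star h)) c b = coeff (star (diagOp h)) c b
    rw [coeff_star, coeff_diagOp, coeff_diagOp]
    by_cases hcb : c = b
    · rw [if_pos hcb, if_pos hcb.symm, hcb]; rfl
    · rw [if_neg hcb, if_neg fun h' => hcb h'.symm, star_zero]

theorem coeff_sub {G : Type*} (S T : BL2 G) (c b : G) :
    coeff (S - T) c b = coeff S c b - coeff T c b := rfl

/-- The restriction of a function in `C_c(G)` to the unit space. -/
noncomputable def restrictUnits (f : C_c(G, ℂ)) : C₀(units G, ℂ) where
  toFun u := f u
  continuous_toFun := f.continuous.comp continuous_subtype_val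
  zero_at_infty' := by
    have : HasCompactSupport (fun u : units G => f u) :=
      f.hasCompactSupport.comp_isClosedEmbedding isClosed_units.isClosedEmbedding_subtypeVal
    exact this.is_zero_at_infty

theorem coeff_regRep_units (f : C_c(G, ℂ)) (u : units G) :
    coeff (regRep f) u u = f u := by
  classical
  rw [coeff_regRep, if_pos rfl, ginv_of_mem_units u.2, u.2.2]

theorem exists_diag (T : BL2 G) (hT : T ∈ reducedCStar G) :
    ∃ h : C₀(units G, ℂ), ∀ u, h u = coeff T u u := by
  obtain ⟨S, hS, hST⟩ := mem_closure_iff_seq_limit.1 hT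
  choose f hf using hS
  have hdist : ∀ m n, dist (restrictUnits (f m)) (restrictUnits (f n)) ≤ dist (S m) (S n) := by
    intro m n
    rw [← ZeroAtInftyContinuousMap.dist_toBCF_eq_dist,
      BoundedContinuousFunction.dist_le dist_nonneg]
    intro u
    change dist (f m u) (f n u) ≤ _
    rw [← coeff_regRep_units, ← coeff_regRep_units, hf, hf, dist_eq_norm, dist_eq_norm,
      ← coeff_sub]
    exact norm_coeff_le _ _ _
  have hC : CauchySeq fun n => restrictUnits (f n) := by
    have := hST.cauchySeq
    rw [Metric.cauchySeq_iff] at this ⊢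
    intro ε hε
    obtain ⟨N, hN⟩ := this ε hε
    exact ⟨N, fun m hm n hn => (hdist m n).trans_lt (hN m hm n hn)⟩
  obtain ⟨h, hh⟩ := cauchySeq_tendsto_of_complete hC
  refine ⟨h, fun u => ?_⟩
  have h1 : Tendsto (fun n => f n u) atTop (𝓝 (h u)) :=
    ((ZeroAtInftyContinuousMap.tendsto_iff_tendstoUniformly.1 hh).tendsto_at u)
  have h2 : Tendsto (fun n => f n u) atTop (𝓝 (coeff T u u)) := by
    rw [tendsto_iff_norm_sub_tendsto_zero]
    refine squeeze_zero (fun _ => norm_nonneg _) (fun n => ?_)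
      (tendsto_iff_norm_sub_tendsto_zero.1 hST)
    rw [← coeff_regRep_units, hf, ← coeff_sub]
    exact norm_coeff_le _ _ _
  exact tendsto_nhds_unique h1 h2

/-- The function `u ↦ ⟨T δ_u, δ_u⟩` on the unit space. -/
noncomputable def expectFun (T : reducedCStar G) : C₀(units G, ℂ) where
  toFun u := coeff (T : BL2 G) u u
  continuous_toFun := by
    obtain ⟨h, hh⟩ := exists_diag T.1 T.2
    rw [← funext hh]
    exact map_continuous h
  zero_at_infty' := by
    obtain ⟨h, hh⟩ := exists_diag T.1 T.2
    rw [← funext hh]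
    exact zero_at_infty h

/-- The natural expectation `C^*_red(G) → C₀(G⁰)`: the continuous extension of the restriction map
`C_c(G) → C₀(G⁰)` (see `expect_ofCc`), given by the diagonal matrix coefficients at the units. -/
noncomputable def expect (G : Type*) [TopologicalSpace G] [AlgGroupoid G] [EtaleGroupoid G] :
    reducedCStar G →L[ℂ] C₀(units G, ℂ) :=
  LinearMap.mkContinuous
    { toFun := expectFun
      map_add' := fun _ _ => rfl
      map_smul' := fun _ _ => rfl }
    1 fun T => by
      rw [one_mul, ← ZeroAtInftyContinuousMap.norm_toBCF_eq_norm,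
        BoundedContinuousFunction.norm_le (norm_nonneg _)]
      exact fun u => norm_coeff_le _ _ _

theorem expect_apply (T : reducedCStar G) (u : units G) :
    expect G T u = coeff (T : BL2 G) u u := rfl

/-- The inclusion of `C₀(G⁰)` extends the inclusion of `C_c(G⁰)` into `C_c(G)`. -/
theorem incl_restrictUnits (f : C_c(G, ℂ)) (hf : ∀ a ∉ units G, f a = 0) :
    incl G (restrictUnits f) = ofCc f := by
  apply Subtype.ext
  ext x c
  exact (regRep_of_units f hf x c).symm

theorem expect_ofCc (f : C_c(G, ℂ)) : expect G (ofCc f) = restrictUnits f := by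
  ext u
  rw [expect_apply]
  exact coeff_regRep_units f u

theorem expect_incl (h : C₀(units G, ℂ)) : expect G (incl G h) = h := by
  classical
  ext u
  rw [expect_apply]
  change coeff (diagOp h) u u = _
  rw [coeff_diagOp, if_pos rfl]
  congr 1
  exact Subtype.ext (rg_of_mem_units u.2)

end Inclusion

section States

/-- States of a (possibly non-unital) `C^*`-algebra: positive functionals of norm one. -/
def IsState {A : Type*} [NonUnitalNormedRing A] [StarRing A] [NormedSpace ℂ A]
    (φ : A →L[ℂ] ℂ) : Prop :=
  (∀ a : A, 0 ≤ (φ (star a * a)).re ∧ (φ (star a * a)).im = 0) ∧ ‖φ‖ = 1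

/-- Tracial states. -/
def IsTracialState {A : Type*} [NonUnitalNormedRing A] [StarRing A] [NormedSpace ℂ A]
    (φ : A →L[ℂ] ℂ) : Prop :=
  IsState φ ∧ ∀ a b : A, φ (a * b) = φ (b * a)

variable {A B : Type*} [NonUnitalRing A] [StarRing A] [Module ℂ A]
  [NonUnitalRing B] [StarRing B] [Module ℂ B]

/-- For an inclusion `j : B → A`, the set `N(B)` of all `n ∈ A` with
`n B n^* ∪ n^* B n ⊂ B`. -/
def normalizers (j : B →⋆ₙₐ[ℂ] A) : Set A :=
  {n | ∀ b : B, n * j b * star n ∈ Set.range j ∧ star n * j b * n ∈ Set.range j}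

/-- For an inclusion `j : B → A`, the functional `φ` on `B` is `n`-invariant:
for every `b ∈ B`, the elements `n b n^*` and `n^* n b` lie in `B`, and `φ` takes the same value
at both. -/
def IsInvariantAt (j : B →⋆ₙₐ[ℂ] A) (φ : B → ℂ) (n : A) : Prop :=
  ∀ b : B, ∃ c d : B, j c = n * j b * star n ∧ j d = star n * n * j b ∧ φ c = φ d

/-- The functional `φ` is `N₀`-invariant: it is `n`-invariant for every `n ∈ N₀`. -/
def IsInvariantOn (j : B →⋆ₙₐ[ℂ] A) (φ : B → ℂ) (N : Set A) : Prop :=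
  ∀ n ∈ N, IsInvariantAt j φ n

/-- The functional `φ` is fully invariant: it is invariant for all normalizers of `B`. -/
def IsFullyInvariant (j : B →⋆ₙₐ[ℂ] A) (φ : B → ℂ) : Prop :=
  IsInvariantOn j φ (normalizers j)

end States

section Balanced

variable {G : Type*} [TopologicalSpace G] [AlgGroupoid G]

/-- The measure `μ` on the unit space is `X`-balanced: `μ(X B X⁻¹) = μ(s(X) ∩ B)` for every Borel
set `B` of units. (The sets `X B X⁻¹` and `s(X)` consist of units.) -/
def IsBalanced [MeasurableSpace G] (μ : Measure (units G)) (X : Set G) : Prop :=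
  ∀ B : Set (units G), MeasurableSet B →
    μ {u | (u : G) ∈ setMul (setMul X (Subtype.val '' B)) (setInv X)} =
      μ ({u | (u : G) ∈ sr '' X} ∩ B)

/-- The measure `μ` is totally balanced: `X`-balanced for every open bisection `X`. -/
def IsTotallyBalanced [MeasurableSpace G] (μ : Measure (units G)) : Prop :=
  ∀ X : Set G, IsOpenBisection X → IsBalanced μ X

variable [EtaleGroupoid G]

/-- The elementary normalizers: the elements of `C_c(X)`, for `X` an open bisection. -/
def elementaryNormalizers (G : Type*) [TopologicalSpace G] [AlgGroupoid G] [EtaleGroupoid G] :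
    Set (reducedCStar G) :=
  {n | ∃ X : Set G, IsOpenBisection X ∧ ∃ f : C_c(G, ℂ), tsupport f ⊆ X ∧ n = ofCc f}

/-- The functional `φ` on `C₀(G⁰)` is elementary invariant. -/
def IsElementaryInvariant (φ : C₀(units G, ℂ) → ℂ) : Prop :=
  IsInvariantOn (incl G) φ (elementaryNormalizers G)

/-- The functional `φ_μ(h) = ∫ h dμ` on `C₀(S)`. -/
noncomputable def phi {S : Type*} [TopologicalSpace S] [SecondCountableTopology S]
    [MeasurableSpace S] [BorelSpace S]
    (μ : Measure S) [IsProbabilityMeasure μ] : C₀(S, ℂ) →L[ℂ] ℂ :=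
  have hint : ∀ h : C₀(S, ℂ), Integrable (fun u => h u) μ := fun h =>
    BoundedContinuousFunction.integrable μ h.toBCF
  LinearMap.mkContinuous
    { toFun := fun h => ∫ u, h u ∂μ
      map_add' := fun h k => integral_add (hint h) (hint k)
      map_smul' := fun z h => integral_const_mul z (fun u => h u) }
    1 fun h => by
      rw [one_mul]
      have := norm_integral_le_of_norm_le_const (μ := μ) (f := fun u => h u) (C := ‖h‖)
        (Eventually.of_forall fun u => h.toBCF.norm_coe_le_norm u)
      simpa using this

end Balanced

end GroupoidCStar

/-! Everything reduces to comparing two measures on each open bisection X: the pullbacks of μ along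
the range and along the source map restricted to X. By `isBalanced_iff`, these coincide exactly when
μ is X-balanced.

The link with the algebra is that a convolution with a factor f supported in X has only one relevant
term at a unit. For arbitrary g, the value of f × g at r(a) and the value of g × f at s(a) are both
f(a) g(a⁻¹), for a in X. Hence applying φ_μ ∘ E to f × g and to g × f integrates the same function
on X against the two pullbacks (`integral_conv_rg`, `integral_conv_sr`).

The conditions are then closed into a cycle. If μ is totally balanced, the trace identity holds for
f supported in a bisection, for all f in C_c(G) by a partition of unity, and on the whole algebra by
density. A trace gives the same value to (n b) n* and n* (n b), which is full invariance. Full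
invariance contains elementary invariance, because functions supported in bisections normalize B
(`elementaryNormalizers_subset`).

Finally, elementary invariance says that |f|² has the same integral against both pullbacks, for
every f supported in X. Square roots turn this into equality on all non-negative functions in
C_c(X), and such integrals determine a regular measure.

Since neither algebra need be unital, cut-off functions in B replace the unit throughout. -/

namespace GroupoidCStar

/-! ### Values of convolutions at units, and vanishing off the units -/

section Convolution

variable {G : Type*} [TopologicalSpace G] [AlgGroupoid G]

theorem gmul_ginv_rg {G : Type*} [AlgGroupoid G] (a : G) : gmul (ginv a) (rg a) = ginv a := by
  simpa [sr_ginv] using gmul_sr_self (ginv a)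

theorem gmul_ginv_unit {G : Type*} [AlgGroupoid G] {a u : G} (h : rg a = u) :
    gmul (ginv a) u = ginv a := by
  rw [← h, gmul_ginv_rg]

/-- Convolution by a function supported in an open bisection on the left, at a range unit. -/
theorem conv_rg {X : Set G} (hX : IsOpenBisection X) {f : G → ℂ} (hf : ∀ a ∉ X, f a = 0)
    (g : G → ℂ) {a : G} (ha : a ∈ X) : conv f g (rg a) = f a * g (ginv a) := by
  rw [conv_bisection hX hf g ha (rg_rg a).symm, gmul_ginv_rg]

/-- Convolution by a function supported in an open bisection on the right, at a source unit. -/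
theorem conv_sr {X : Set G} (hX : IsOpenBisection X) {f : G → ℂ} (hf : ∀ a ∉ X, f a = 0)
    (g : G → ℂ) {a : G} (ha : a ∈ X) : conv g f (sr a) = f a * g (ginv a) := by
  rw [conv_eq_finsum, finsum_mem_eq_sum_of_subset (t := {ginv a})]
  · rw [Finset.sum_singleton, gmul_ginv_unit (rg_ginv a), ginv_ginv, mul_comm]
  · rintro b ⟨hb, hb'⟩
    have hb1 : rg b = sr a := hb.trans (rg_sr a)
    have hbX : ginv b ∈ X := by
      by_contra h
      apply hb'
      simp only [gmul_ginv_unit hb1, hf _ h, mul_zero]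
    -- A non-zero term needs b⁻¹ in X with source s(a), which forces b⁻¹ = a.
    have := hX.injOn_sr hbX ha ((sr_ginv b).trans hb1)
    simp [← this, ginv_ginv]
  · intro b hb
    have : b = ginv a := by simpa using hb
    rw [this]
    change rg (ginv a) = rg (sr a)
    rw [rg_ginv, rg_sr]

/-- Unlike `conv_eq_zero`, this allows either factor to be the one that vanishes in a given term. -/
theorem conv_eq_zero_of_forall {G : Type*} [AlgGroupoid G] {f g : G → ℂ} {c : G}
    (h : ∀ a, rg a = rg c → f a * g (gmul (ginv a) c) = 0) : conv f g c = 0 := by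
  rw [conv_eq_finsum]
  exact finsum_mem_eq_zero_of_forall_eq_zero h

theorem conv_eq_zero_of_notMem_sr {G : Type*} [AlgGroupoid G] {X : Set G}
    {f : G → ℂ} (hf : ∀ a ∉ X, f a = 0)
    (g : G → ℂ) {u : G} (hu : u ∈ units G) (h : u ∉ sr '' X) : conv g f u = 0 := by
  refine conv_eq_zero_of_forall fun b hb => ?_
  rw [rg_of_mem_units hu] at hb
  rw [gmul_ginv_unit hb, hf, mul_zero]
  exact fun hbX => h ⟨_, hbX, by rw [sr_ginv, hb]⟩

/-- A convolution vanishes off the units if the factors are supported in `X` and `X⁻¹` and the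
source map is injective on `X`. -/
theorem conv_eq_zero_of_injOn_sr {G : Type*} [AlgGroupoid G] {X : Set G}
    (hX : InjOn sr X) {f g : G → ℂ}
    (hf : ∀ a ∉ X, f a = 0) (hg : ∀ a, ginv a ∉ X → g a = 0) {c : G} (hc : c ∉ units G) :
    conv f g c = 0 := by
  refine conv_eq_zero_of_forall fun a ha => ?_
  by_contra h
  have h1 : a ∈ X := by_contra fun h' => h (by rw [hf a h', zero_mul])
  have h2 : ginv (gmul (ginv a) c) ∈ X := by_contra fun h' => h (by rw [hg _ h', mul_zero])
  have hs : sr (ginv a) = rg c := by rw [sr_ginv, ha]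
  -- Both a and (a⁻¹c)⁻¹ lie in X and have source s(a), so they are equal. Then a⁻¹c = a⁻¹, and c =
  -- a a⁻¹ is a unit.
  have h3 := hX h1 h2 (by rw [sr_ginv, rg_gmul hs, rg_ginv])
  have h4 : gmul (ginv a) c = ginv a := by
    conv_rhs => rw [h3]
    rw [ginv_ginv]
  have h5 := gmul_ginv_gmul ha
  rw [h4] at h5
  exact hc (h5 ▸ rg_mem_units a)

/-- A convolution vanishes off the units if the factors are supported in `X⁻¹` and `X` and the
range map is injective on `X`. -/
theorem conv_eq_zero_of_injOn_rg {G : Type*} [AlgGroupoid G] {X : Set G}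
    (hX : InjOn rg X) {f g : G → ℂ}
    (hf : ∀ a ∉ X, f a = 0) (hg : ∀ a, ginv a ∉ X → g a = 0) {c : G} (hc : c ∉ units G) :
    conv g f c = 0 := by
  refine conv_eq_zero_of_forall fun a ha => ?_
  by_contra h
  have h1 : gmul (ginv a) c ∈ X := by_contra fun h' => h (by rw [hf _ h', mul_zero])
  have h2 : ginv a ∈ X := by_contra fun h' => h (by rw [hg a h', zero_mul])
  have hs : sr (ginv a) = rg c := by rw [sr_ginv, ha]
  -- Here a⁻¹c and a⁻¹ lie in X and have the same range, so they are equal and again c = a a⁻¹.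
  have h3 := hX h1 h2 (rg_gmul hs)
  have h5 := gmul_ginv_gmul ha
  rw [h3] at h5
  exact hc (h5 ▸ rg_mem_units a)

end Convolution

/-! ### Balancedness and integration on an open bisection -/

section Bisection

variable {G : Type*} [TopologicalSpace G] [AlgGroupoid G]

/-- Bisections are defined by maps into G, while μ lives on the unit space; openness of the units in
G lets the embedding property pass to the smaller codomain. -/
theorem IsOpenBisection.isOpenEmbedding_rgU [EtaleGroupoid G] {X : Set G}
    (hX : IsOpenBisection X) : IsOpenEmbedding (X.domRestrict (rgU : G → units G)) :=
  .of_comp (g := Subtype.val) _ isOpen_units.isOpenEmbedding_subtypeVal hX.2.1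

theorem IsOpenBisection.isOpenEmbedding_srU [EtaleGroupoid G] {X : Set G}
    (hX : IsOpenBisection X) : IsOpenEmbedding (X.domRestrict (srU : G → units G)) :=
  .of_comp (g := Subtype.val) _ isOpen_units.isOpenEmbedding_subtypeVal hX.2.2

theorem IsOpenBisection.measurableEmbedding_rgU [EtaleGroupoid G] [MeasurableSpace G]
    [BorelSpace G] {X : Set G} (hX : IsOpenBisection X) :
    MeasurableEmbedding (X.domRestrict (rgU : G → units G)) :=
  hX.isOpenEmbedding_rgU.measurableEmbedding

theorem IsOpenBisection.measurableEmbedding_srU [EtaleGroupoid G] [MeasurableSpace G]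
    [BorelSpace G] {X : Set G} (hX : IsOpenBisection X) :
    MeasurableEmbedding (X.domRestrict (srU : G → units G)) :=
  hX.isOpenEmbedding_srU.measurableEmbedding

/-- In a product a v b⁻¹ with v a unit, composability gives s(a) = v = s(b). Injectivity of s on X
then gives a = b, and the product is r(a). -/
theorem setOf_mem_setMul_setInv {X : Set G} (hX : IsOpenBisection X) (A : Set (units G)) :
    {u : units G | (u : G) ∈ setMul (setMul X (Subtype.val '' A)) (setInv X)} =
      X.domRestrict (rgU : G → units G) '' (X.domRestrict (srU : G → units G) ⁻¹' A) := by
  ext u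
  constructor
  · rintro ⟨_, ⟨a, ha, _, ⟨v, hv, rfl⟩, hav, rfl⟩, _, ⟨b, hb, rfl⟩, hab, h⟩
    have h1 : sr a = v := (composable_iff.1 hav).trans (rg_of_mem_units v.2)
    rw [← h1, gmul_sr_self] at hab h
    have h2 : a = b := hX.injOn_sr ha hb ((composable_iff.1 hab).trans (rg_ginv b))
    subst h2
    refine ⟨⟨a, ha⟩, ?_, Subtype.ext h⟩
    have : srU a = v := Subtype.ext h1
    change srU a ∈ A
    rwa [this]
  · rintro ⟨⟨a, ha⟩, haA, rfl⟩
    exact ⟨a, ⟨a, ha, sr a, ⟨srU a, haA, rfl⟩, comp_sr a, gmul_sr_self a⟩, ginv a,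
      ⟨a, ha, rfl⟩, comp_ginv a, rfl⟩

theorem setOf_mem_sr_image_inter {G : Type*} [AlgGroupoid G] (X : Set G) (A : Set (units G)) :
    {u : units G | (u : G) ∈ sr '' X} ∩ A =
      X.domRestrict (srU : G → units G) '' (X.domRestrict (srU : G → units G) ⁻¹' A) := by
  rw [Set.image_preimage_eq_inter_range, Set.inter_comm]
  congr 1
  ext u
  constructor
  · rintro ⟨a, ha, h⟩
    exact ⟨⟨a, ha⟩, Subtype.ext h⟩
  · rintro ⟨⟨a, ha⟩, rfl⟩
    exact ⟨a, ha, rfl⟩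

/-- A measure is balanced for a bisection if and only if it pulls back to the same measure on the
bisection under the range and the source map. -/
theorem isBalanced_iff [EtaleGroupoid G] [MeasurableSpace G] [BorelSpace G]
    (μ : Measure (units G)) {X : Set G} (hX : IsOpenBisection X) :
    IsBalanced μ X ↔ μ.comap (X.domRestrict (rgU : G → units G)) =
      μ.comap (X.domRestrict (srU : G → units G)) := by
  have key : IsBalanced μ X ↔ ∀ A : Set (units G), MeasurableSet A →
      μ.comap (X.domRestrict (rgU : G → units G)) (X.domRestrict (srU : G → units G) ⁻¹' A) =
      μ.comap (X.domRestrict (srU : G → units G)) (X.domRestrict (srU : G → units G) ⁻¹' A) := by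
    refine forall₂_congr fun A hA => ?_
    rw [setOf_mem_setMul_setInv hX, setOf_mem_sr_image_inter,
      hX.measurableEmbedding_rgU.comap_apply, hX.measurableEmbedding_srU.comap_apply]
  rw [key]
  constructor
  · intro h
    refine Measure.ext fun E hE => ?_
    -- Testing on source preimages is enough: every Borel E in X is the source preimage of s(E),
    -- which is Borel since s is a measurable embedding on X.
    have := h _ (hX.measurableEmbedding_srU.measurableSet_image.2 hE)
    rwa [preimage_image_eq _ hX.measurableEmbedding_srU.injective] at this
  · intro h A _
    rw [h]

theorem _root_.MeasurableEmbedding.integral_comap {X Y : Type*} [MeasurableSpace X]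
    [MeasurableSpace Y] {e : X → Y} (he : MeasurableEmbedding e) (μ : Measure Y) {ψ : Y → ℂ}
    (hψ : ∀ y ∉ range e, ψ y = 0) : ∫ x, ψ (e x) ∂μ.comap e = ∫ y, ψ y ∂μ := by
  rw [← he.integral_map, he.map_comap, setIntegral_eq_integral_of_forall_compl_eq_zero hψ]

variable [EtaleGroupoid G] [MeasurableSpace G] [BorelSpace G]

/-- On the units, f × g vanishes outside r(X), so the integral can be transported to X, where
`conv_rg` evaluates it. -/
theorem integral_conv_rg (μ : Measure (units G)) {X : Set G} (hX : IsOpenBisection X)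
    {f : G → ℂ} (hf : ∀ a ∉ X, f a = 0) (g : G → ℂ) :
    ∫ u : units G, conv f g u ∂μ =
      ∫ a : X, f a * g (ginv a) ∂μ.comap (X.domRestrict (rgU : G → units G)) := by
  rw [← hX.measurableEmbedding_rgU.integral_comap μ (ψ := fun u => conv f g u)]
  · exact integral_congr_ae (Eventually.of_forall fun a => conv_rg hX hf g a.2)
  · intro u hu
    refine conv_eq_zero g fun a ha => hf a fun haX => hu ⟨⟨a, haX⟩, Subtype.ext ?_⟩
    exact ha.trans (rg_of_mem_units u.2)

theorem integral_conv_sr (μ : Measure (units G)) {X : Set G} (hX : IsOpenBisection X)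
    {f : G → ℂ} (hf : ∀ a ∉ X, f a = 0) (g : G → ℂ) :
    ∫ u : units G, conv g f u ∂μ =
      ∫ a : X, f a * g (ginv a) ∂μ.comap (X.domRestrict (srU : G → units G)) := by
  rw [← hX.measurableEmbedding_srU.integral_comap μ (ψ := fun u => conv g f u)]
  · exact integral_congr_ae (Eventually.of_forall fun a => conv_sr hX hf g a.2)
  · intro u hu
    refine conv_eq_zero_of_notMem_sr hf g u.2 ?_
    rintro ⟨a, haX, ha⟩
    exact hu ⟨⟨a, haX⟩, Subtype.ext ha⟩

end Bisection

/-! ### The inclusion of C₀(G⁰), cut-offs and normalizers -/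

section ReducedAlgebra

variable {G : Type*} [TopologicalSpace G] [AlgGroupoid G] [EtaleGroupoid G]

theorem ofCc_add (f g : C_c(G, ℂ)) : ofCc (f + g) = ofCc f + ofCc g :=
  Subtype.ext (regRep_add f g)

theorem ofCc_mul (f g : C_c(G, ℂ)) : ofCc f * ofCc g = ofCc (ccConv f g) :=
  Subtype.ext (regRep_conv f g).symm

theorem star_ofCc (f : C_c(G, ℂ)) : star (ofCc f) = ofCc (ccStar f) :=
  Subtype.ext (regRep_star f).symm

theorem dense_ofCc : Dense (range (ofCc : C_c(G, ℂ) → reducedCStar G)) := by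
  intro T
  have hT : (T : BL2 G) ∈ closure (range (regRep : C_c(G, ℂ) → BL2 G)) := T.2
  rw [Metric.mem_closure_iff] at hT ⊢
  intro ε hε
  obtain ⟨_, ⟨f, rfl⟩, hf⟩ := hT ε hε
  exact ⟨_, ⟨f, rfl⟩, hf⟩

/-- The product `f · (b ∘ s)`. -/
noncomputable def mulSource (f : C_c(G, ℂ)) (b : C₀(units G, ℂ)) : C_c(G, ℂ) where
  toFun a := f a * b (srU a)
  continuous_toFun := f.continuous.mul ((map_continuous b).comp continuous_srU)
  hasCompactSupport' := f.hasCompactSupport.mul_right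

theorem mulSource_apply (f : C_c(G, ℂ)) (b : C₀(units G, ℂ)) (a : G) :
    mulSource f b a = f a * b (srU a) := rfl

theorem ofCc_mul_incl (f : C_c(G, ℂ)) (b : C₀(units G, ℂ)) :
    ofCc f * incl G b = ofCc (mulSource f b) := by
  apply Subtype.ext
  ext x c
  change conv f (fun a => b (rgU a) * x a) c = conv (mulSource f b) x c
  rw [conv_eq_finsum, conv_eq_finsum]
  refine finsum_mem_congr rfl fun a ha => ?_
  -- In each term b is evaluated at the range of a⁻¹c, which is s(a); so b can be absorbed into f.
  have h : rgU (gmul (ginv a) c) = srU a :=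
    Subtype.ext ((rg_gmul ((sr_ginv a).trans ha)).trans (rg_ginv a))
  rw [h, mulSource_apply, mul_assoc]

theorem norm_incl_le (h : C₀(units G, ℂ)) : ‖incl G h‖ ≤ ‖h‖ :=
  ContinuousLinearMap.opNorm_le_bound _ (norm_nonneg h) fun x =>
    norm_diag_le (norm_nonneg h) (fun c => h.toBCF.norm_coe_le_norm (rgU c)) x _ fun _ => rfl

theorem norm_expect_le : ‖expect G‖ ≤ 1 :=
  LinearMap.mkContinuous_norm_le _ zero_le_one _

theorem mem_range_incl_iff {T : reducedCStar G} :
    T ∈ range (incl G) ↔ incl G (expect G T) = T :=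
  ⟨fun ⟨h, hh⟩ => by rw [← hh, expect_incl], fun h => ⟨_, h⟩⟩

theorem continuous_incl : Continuous (incl G) :=
  AddMonoidHomClass.continuous_of_bound (incl G) 1 fun h => by
    rw [one_mul]; exact norm_incl_le h

/-- The image of B is the fixed-point set of the continuous map `incl G` ∘ `expect G`. -/
theorem isClosed_range_incl : IsClosed (range (incl G)) := by
  have : range (incl G) = {T | incl G (expect G T) = T} := by
    ext T; exact mem_range_incl_iff
  rw [this]
  exact isClosed_eq (continuous_incl.comp (expect G).continuous) continuous_id

/-- A cut-off function on the unit space. -/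
theorem exists_cutoff {K : Set (units G)} (hK : IsCompact K) :
    ∃ (h : C₀(units G, ℂ)) (χ : units G → ℝ), Continuous χ ∧ (∀ u, h u = χ u) ∧
      (∀ u ∈ K, χ u = 1) ∧ ∀ u, χ u ∈ Icc (0 : ℝ) 1 := by
  obtain ⟨χ, h1, -, hc, hχ⟩ := exists_continuous_one_zero_of_isCompact hK isClosed_empty
    (disjoint_empty K)
  have hc' : HasCompactSupport (fun u => (χ u : ℂ)) :=
    hc.comp_left (g := fun x : ℝ => (x : ℂ)) Complex.ofReal_zero
  exact ⟨⟨⟨fun u => (χ u : ℂ), by fun_prop⟩, hc'.is_zero_at_infty⟩, χ, χ.continuous,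
    fun _ => rfl, fun u hu => h1 hu, hχ⟩

theorem norm_le_one_of_cutoff {G : Type*} [TopologicalSpace G] [AlgGroupoid G]
    {h : C₀(units G, ℂ)} {χ : units G → ℝ} (hχ : ∀ u, h u = χ u)
    (hχ' : ∀ u, χ u ∈ Icc (0 : ℝ) 1) : ‖h‖ ≤ 1 := by
  rw [← ZeroAtInftyContinuousMap.norm_toBCF_eq_norm,
    BoundedContinuousFunction.norm_le zero_le_one]
  intro u
  change ‖h u‖ ≤ 1
  rw [hχ, Complex.norm_real, Real.norm_of_nonneg (hχ' u).1]
  exact (hχ' u).2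

theorem incl_mul_ofCc (h : C₀(units G, ℂ)) (f : C_c(G, ℂ))
    (hf : ∀ a ∈ tsupport f, h (rgU a) = 1) : incl G h * ofCc f = ofCc f := by
  apply Subtype.ext
  ext x c
  change h (rgU c) * conv f x c = conv f x c
  by_cases hc : ∃ a ∈ tsupport f, rg a = rg c
  · obtain ⟨a, ha, hac⟩ := hc
    have : rgU c = rgU a := Subtype.ext hac.symm
    rw [this, hf a ha, one_mul]
  · rw [conv_eq_zero, mul_zero]
    exact fun a hac => image_eq_zero_of_notMem_tsupport fun ha => hc ⟨a, ha, hac⟩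

/-- The algebra `C₀(G⁰)` contains approximate units of the reduced algebra. -/
theorem exists_norm_incl_mul_sub_lt (T : reducedCStar G) {ε : ℝ} (hε : 0 < ε) :
    ∃ h : C₀(units G, ℂ), ‖incl G h * T - T‖ < ε := by
  obtain ⟨_, ⟨f, rfl⟩, hf⟩ := Metric.mem_closure_iff.1 (dense_ofCc T) (ε / 2) (half_pos hε)
  rw [dist_eq_norm] at hf
  obtain ⟨h, χ, -, hχ, h1, hχ'⟩ := exists_cutoff (f.hasCompactSupport.isCompact.image continuous_rgU)
  refine ⟨h, ?_⟩
  have e1 := incl_mul_ofCc h f fun a ha => by rw [hχ, h1 _ ⟨a, ha, rfl⟩, Complex.ofReal_one]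
  -- As h fixes the approximant f, only the error T - f remains, counted twice; hence the choice ε /
  -- 2.
  have e2 : incl G h * T - T = incl G h * (T - ofCc f) - (T - ofCc f) := by
    rw [mul_sub, e1]; abel
  have e3 : ‖incl G h * (T - ofCc f)‖ ≤ ‖T - ofCc f‖ := by
    refine (norm_mul_le _ _).trans (mul_le_of_le_one_left (norm_nonneg _) ?_)
    exact (norm_incl_le h).trans (norm_le_one_of_cutoff hχ hχ')
  rw [e2]
  linarith [norm_sub_le (incl G h * (T - ofCc f)) (T - ofCc f)]

/-- The normalizer condition gives n* h n in B for h in B, but h = 1 may be unavailable. Letting h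
run through an approximate unit, n* h n tends to n* n, and B is closed. -/
theorem star_mul_self_mem_range_incl {n : reducedCStar G} (hn : n ∈ normalizers (incl G)) :
    star n * n ∈ range (incl G) := by
  rw [← isClosed_range_incl.closure_eq, Metric.mem_closure_iff]
  intro ε hε
  -- The added 1 keeps the denominator positive when n = 0.
  obtain ⟨h, hh⟩ := exists_norm_incl_mul_sub_lt n (div_pos hε (by positivity : 0 < ‖star n‖ + 1))
  refine ⟨_, (hn h).2, ?_⟩
  rw [dist_comm, dist_eq_norm, mul_assoc, ← mul_sub]
  refine (norm_mul_le _ _).trans_lt ?_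
  rw [lt_div_iff₀ (by positivity)] at hh
  nlinarith [norm_nonneg (incl G h * n - n)]

/-- Multiplying by b does not enlarge supports, so the two products are supported in X X⁻¹ and X⁻¹
X. These consist of units by injectivity of s and of r on X, and a function in C_c(G) living on the
units belongs to B. -/
theorem elementaryNormalizers_subset : elementaryNormalizers G ⊆ normalizers (incl G) := by
  rintro _ ⟨X, hX, f, hf, rfl⟩ b
  have hf0 : ∀ a ∉ X, f a = 0 := fun a ha => image_eq_zero_of_notMem_tsupport fun h => ha (hf h)
  have hf1 : ∀ a, ginv a ∉ X → ccStar f a = 0 := fun a ha => by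
    change star (f (ginv a)) = 0
    rw [hf0 _ ha, star_zero]
  constructor
  · rw [star_ofCc, ofCc_mul_incl, ofCc_mul]
    refine ⟨_, incl_restrictUnits _ fun c hc => ?_⟩
    refine conv_eq_zero_of_injOn_sr hX.injOn_sr (fun a ha => ?_) hf1 hc
    rw [mulSource_apply, hf0 a ha, zero_mul]
  · rw [star_ofCc, ofCc_mul_incl, ofCc_mul]
    refine ⟨_, incl_restrictUnits _ fun c hc => ?_⟩
    refine conv_eq_zero_of_injOn_rg hX.injOn_rg hf0 (fun a ha => ?_) hc
    rw [mulSource_apply, hf1 a ha, zero_mul]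

/-- The coefficient equals ‖T δ_u‖². It yields positivity of φ_μ ∘ E pointwise on the units. -/
theorem coeff_star_mul_self {G : Type*} (T : BL2 G) (u : G) :
    0 ≤ (coeff (star T * T) u u).re ∧ (coeff (star T * T) u u).im = 0 := by
  classical
  have h1 := lp.inner_single_left (𝕜 := ℂ) u (1 : ℂ) (star T (T (lp.single 2 u 1)))
  rw [ContinuousLinearMap.star_eq_adjoint, ContinuousLinearMap.adjoint_inner_right,
    inner_self_eq_norm_sq_to_K] at h1
  have h2 : coeff (star T * T) u u = ((‖T (lp.single 2 u 1)‖ ^ 2 : ℝ) : ℂ) := by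
    have h3 : coeff (star T * T) u u = inner ℂ (1 : ℂ)
        ((ContinuousLinearMap.adjoint T) (T (lp.single 2 u 1)) u) := by
      rw [RCLike.inner_apply]
      simp [coeff, ContinuousLinearMap.star_eq_adjoint]
    rw [h3, ← h1]
    push_cast
    rfl
  rw [h2]
  exact ⟨by rw [Complex.ofReal_re]; positivity, Complex.ofReal_im _⟩

end ReducedAlgebra

/-! ### The state φ_μ ∘ E and the implications between the conditions -/

section Equivalence

variable {G : Type*} [TopologicalSpace G] [AlgGroupoid G] [EtaleGroupoid G]
  [MeasurableSpace G] [BorelSpace G] (μ : Measure (units G)) [IsProbabilityMeasure μ]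

theorem phi_apply (h : C₀(units G, ℂ)) : phi μ h = ∫ u, h u ∂μ := rfl

theorem norm_phi_le : ‖phi μ‖ ≤ 1 := by
  refine ContinuousLinearMap.opNorm_le_bound _ zero_le_one fun h => ?_
  have := norm_integral_le_of_norm_le_const (μ := μ) (f := fun u => h u) (C := ‖h‖)
    (Eventually.of_forall fun u => h.toBCF.norm_coe_le_norm u)
  simpa [phi_apply] using this

theorem phi_expect_ofCc (f : C_c(G, ℂ)) :
    phi μ (expect G (ofCc f)) = ∫ u : units G, f u ∂μ := by
  rw [expect_ofCc]; rfl

theorem integrable_zeroAtInfty {S : Type*} [TopologicalSpace S] [SecondCountableTopology S]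
    [MeasurableSpace S] [BorelSpace S] (μ : Measure S) [IsFiniteMeasure μ] (h : C₀(S, ℂ)) :
    Integrable (fun u => h u) μ :=
  BoundedContinuousFunction.integrable μ h.toBCF

/-- Inner regularity provides compact sets K of measure close to 1; a cut-off equal to 1 on K has
norm at most 1 and integral at least μ(K). -/
theorem one_le_norm_phi_comp_expect [μ.Regular] : 1 ≤ ‖(phi μ).comp (expect G)‖ := by
  refine le_of_forall_lt fun r hr => ?_
  -- Negative r is split off because `ENNReal.ofReal` truncates it to 0.
  obtain hr0 | hr0 := lt_or_ge r 0
  · exact hr0.trans_le (ContinuousLinearMap.opNorm_nonneg _)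
  have hr1 : ENNReal.ofReal r < μ univ := by
    rw [measure_univ]
    exact ENNReal.ofReal_lt_one.2 hr
  obtain ⟨K, -, hK, hrK⟩ := isOpen_univ.exists_lt_isCompact hr1
  obtain ⟨h, χ, hχc, hχ, h1, hχ'⟩ := exists_cutoff hK
  have hint : Integrable χ μ := by
    have := (integrable_zeroAtInfty μ h).re
    refine this.congr (Eventually.of_forall fun u => ?_)
    simp [hχ]
  have e1 : phi μ (expect G (incl G h)) = ((∫ u, χ u ∂μ : ℝ) : ℂ) := by
    rw [expect_incl, phi_apply, ← integral_complex_ofReal]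
    exact integral_congr_ae (Eventually.of_forall hχ)
  have e2 : μ.real K ≤ ∫ u, χ u ∂μ := by
    rw [← integral_indicator_one hK.measurableSet]
    refine integral_mono ((integrable_const 1).indicator hK.measurableSet) hint fun u => ?_
    by_cases hu : u ∈ K
    · simp [hu, h1 u hu]
    · simpa [hu] using (hχ' u).1
  have e3 := ((phi μ).comp (expect G)).le_opNorm (incl G h)
  rw [ContinuousLinearMap.comp_apply, e1, Complex.norm_real] at e3
  calc r < μ.real K := (ENNReal.ofReal_lt_iff_lt_toReal hr0 (measure_ne_top μ K)).1 hrK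
    _ ≤ ‖∫ u, χ u ∂μ‖ := e2.trans (le_abs_self _)
    _ ≤ _ := e3
    _ ≤ ‖(phi μ).comp (expect G)‖ := mul_le_of_le_one_right (ContinuousLinearMap.opNorm_nonneg _)
        ((norm_incl_le h).trans (norm_le_one_of_cutoff hχ hχ'))

theorem isState_phi_comp_expect [μ.Regular] : IsState ((phi μ).comp (expect G)) := by
  refine ⟨fun T => ?_, le_antisymm ?_ (one_le_norm_phi_comp_expect μ)⟩
  · have h := fun u : units G => coeff_star_mul_self (T : BL2 G) u
    change 0 ≤ (∫ u, (expect G (star T * T)) u ∂μ).re ∧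
      (∫ u, (expect G (star T * T)) u ∂μ).im = 0
    have e : ∫ u, (expect G (star T * T)) u ∂μ =
        ((∫ u, ((expect G (star T * T)) u).re ∂μ : ℝ) : ℂ) := by
      rw [← integral_complex_ofReal]
      refine integral_congr_ae (Eventually.of_forall fun u => ?_)
      exact Complex.ext rfl (h u).2
    rw [e]
    exact ⟨by rw [Complex.ofReal_re]; exact integral_nonneg fun u => (h u).1,
      Complex.ofReal_im _⟩
  · refine (ContinuousLinearMap.opNorm_comp_le _ _).trans ?_
    exact mul_le_one₀ (norm_phi_le μ) (norm_nonneg _) norm_expect_le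

theorem IsTotallyBalanced.isTracialState [μ.Regular] (h : IsTotallyBalanced μ) :
    IsTracialState ((phi μ).comp (expect G)) := by
  refine ⟨isState_phi_comp_expect μ, ?_⟩
  have key : ∀ f g : C_c(G, ℂ), (phi μ).comp (expect G) (ofCc f * ofCc g) =
      (phi μ).comp (expect G) (ofCc g * ofCc f) := by
    intro f g
    -- Only f has to be decomposed along bisections; g stays arbitrary.
    refine cc_induction (P := fun f => (phi μ).comp (expect G) (ofCc f * ofCc g) =
      (phi μ).comp (expect G) (ofCc g * ofCc f)) ?_ ?_ ?_ f
    · have : ofCc (0 : C_c(G, ℂ)) = 0 := by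
        simpa using ofCc_add (0 : C_c(G, ℂ)) 0
      rw [this, zero_mul, mul_zero]
    · intro f f' hf hf'
      rw [ofCc_add, add_mul, mul_add, map_add, map_add, hf, hf']
    · intro X hX f hf
      have hf0 : ∀ a ∉ X, f a = 0 := fun a ha =>
        image_eq_zero_of_notMem_tsupport fun h => ha (hf h)
      rw [ofCc_mul, ofCc_mul, ContinuousLinearMap.comp_apply, ContinuousLinearMap.comp_apply,
        phi_expect_ofCc, phi_expect_ofCc]
      change ∫ u : units G, conv f g u ∂μ = ∫ u : units G, conv g f u ∂μ
      rw [integral_conv_rg μ hX hf0, integral_conv_sr μ hX hf0, (isBalanced_iff μ hX).1 (h X hX)]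
  intro a b
  have hc := ((phi μ).comp (expect G)).continuous
  refine isClosed_property2 (e := ofCc) dense_ofCc (p := fun a b =>
    (phi μ).comp (expect G) (a * b) = (phi μ).comp (expect G) (b * a)) ?_ key a b
  exact isClosed_eq (hc.comp (continuous_fst.mul continuous_snd))
    (hc.comp (continuous_snd.mul continuous_fst))

theorem IsTracialState.isFullyInvariant (h : IsTracialState ((phi μ).comp (expect G))) :
    IsFullyInvariant (incl G) (phi μ) := by
  intro n hn b
  obtain ⟨c, hc⟩ := (hn b).1
  obtain ⟨d, hd⟩ := star_mul_self_mem_range_incl hn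
  have hd' : incl G (d * b) = star n * n * incl G b := by rw [map_mul, hd]
  refine ⟨c, d * b, hc, hd', ?_⟩
  rw [← expect_incl c, ← expect_incl (d * b), hc, hd', mul_assoc (star n)]
  -- The trace identity is applied to the factors n b and n*.
  exact h.2 (n * incl G b) (star n)

/-- Invariance is used at a b equal to 1 on s(supp f). Then f b = f, so φ_μ takes the same value on
f f* and f* f, and both values are integrals of |f|² over X. -/
theorem IsElementaryInvariant.integral_comap_eq
    (h : IsElementaryInvariant (G := G) (phi μ)) {X : Set G} (hX : IsOpenBisection X)
    {f : C_c(G, ℂ)} (hf : tsupport f ⊆ X) :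
    ∫ a : X, f a * star (f a) ∂μ.comap (X.domRestrict (rgU : G → units G)) =
      ∫ a : X, f a * star (f a) ∂μ.comap (X.domRestrict (srU : G → units G)) := by
  obtain ⟨b, χ, -, hχ, h1, -⟩ := exists_cutoff (f.hasCompactSupport.isCompact.image continuous_srU)
  have hfb : mulSource f b = f := by
    ext a
    rw [mulSource_apply]
    by_cases ha : a ∈ tsupport f
    · rw [hχ, h1 _ ⟨a, ha, rfl⟩, Complex.ofReal_one, mul_one]
    · rw [image_eq_zero_of_notMem_tsupport ha, zero_mul]
  have hf0 : ∀ a ∉ X, f a = 0 := fun a ha => image_eq_zero_of_notMem_tsupport fun h => ha (hf h)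
  obtain ⟨c, d, hc, hd, hcd⟩ := h (ofCc f) ⟨X, hX, f, hf, rfl⟩ b
  rw [ofCc_mul_incl, hfb, star_ofCc, ofCc_mul] at hc
  rw [mul_assoc, ofCc_mul_incl, hfb, star_ofCc, ofCc_mul] at hd
  rw [← expect_incl c, ← expect_incl d, hc, hd, phi_expect_ofCc, phi_expect_ofCc] at hcd
  change ∫ u : units G, conv f (ccStar f) u ∂μ = ∫ u : units G, conv (ccStar f) f u ∂μ at hcd
  rw [integral_conv_rg μ hX hf0, integral_conv_sr μ hX hf0] at hcd
  have e : ∀ a : G, f a * ccStar f (ginv a) = f a * star (f a) := fun a => by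
    change _ * star (f (ginv (ginv a))) = _
    rw [ginv_ginv]
  simpa only [e] using hcd

theorem IsElementaryInvariant.isTotallyBalanced
    (h : IsElementaryInvariant (G := G) (phi μ)) : IsTotallyBalanced μ := by
  intro X hX
  rw [isBalanced_iff μ hX]
  have : LocallyCompactSpace X := hX.1.locallyCompactSpace
  have : IsFiniteMeasure (μ.comap (X.domRestrict (rgU : G → units G))) :=
    ⟨by rw [hX.measurableEmbedding_rgU.comap_apply]; exact measure_lt_top _ _⟩
  have : IsFiniteMeasure (μ.comap (X.domRestrict (srU : G → units G))) :=
    ⟨by rw [hX.measurableEmbedding_srU.comap_apply]; exact measure_lt_top _ _⟩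
  -- The metric serves to make the two finite measures on X regular, so that integrals of compactly
  -- supported functions determine them.
  let _ := TopologicalSpace.metrizableSpaceMetric X
  refine Measure.ext_of_integral_eq_on_compactlySupported_nnreal fun k => ?_
  -- The square root is taken so that |f|² = k on X. Its extension f by zero is continuous on G
  -- because X is open and the support of k is compact in X.
  let k' : X → ℂ := fun a => ((NNReal.sqrt (k a) : ℝ) : ℂ)
  have hkc : Continuous k' := by
    have := NNReal.continuous_sqrt.comp k.continuous
    exact Complex.continuous_ofReal.comp (NNReal.continuous_coe.comp this)
  have hks : HasCompactSupport k' :=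
    k.hasCompactSupport.comp_left (g := fun x : NNReal => ((NNReal.sqrt x : ℝ) : ℂ)) (by simp)
  let f : C_c(G, ℂ) :=
    { toFun := Function.extend Subtype.val k' 0
      continuous_toFun := hks.continuous_extend_zero hX.1 hkc
      hasCompactSupport' := hks.extend_zero continuous_subtype_val }
  have hf : tsupport f ⊆ X := by
    refine (hks.tsupport_extend_zero_subset continuous_subtype_val).trans ?_
    rintro _ ⟨a, -, rfl⟩
    exact a.2
  have hfk : ∀ a : X, f a * star (f a) = ((k a : ℝ) : ℂ) := by
    intro a
    have : f a = ((NNReal.sqrt (k a) : ℝ) : ℂ) := Subtype.val_injective.extend_apply k' 0 a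
    rw [this, Complex.star_def, Complex.conj_ofReal, ← Complex.ofReal_mul, ← NNReal.coe_mul,
      NNReal.mul_self_sqrt]
  have key := h.integral_comap_eq μ hX hf
  simp only [hfk] at key
  rwa [integral_complex_ofReal, integral_complex_ofReal, Complex.ofReal_inj] at key

end Equivalence

end GroupoidCStar

theorem mainTheorem9 {G : Type*} [TopologicalSpace G] [GroupoidCStar.AlgGroupoid G]
    [GroupoidCStar.EtaleGroupoid G] [MeasurableSpace G] [BorelSpace G]
    (μ : MeasureTheory.Measure (GroupoidCStar.units G))
    [MeasureTheory.IsProbabilityMeasure μ] [μ.Regular] :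
    [GroupoidCStar.IsTotallyBalanced μ,
      GroupoidCStar.IsElementaryInvariant (G := G) (GroupoidCStar.phi μ),
      GroupoidCStar.IsFullyInvariant (GroupoidCStar.incl G) (GroupoidCStar.phi μ),
      GroupoidCStar.IsTracialState
        ((GroupoidCStar.phi μ).comp (GroupoidCStar.expect G))].TFAE := by
  tfae_have 1 → 4 := fun h => h.isTracialState μ
  tfae_have 4 → 3 := fun h => h.isFullyInvariant μ
  tfae_have 3 → 2 := fun h n hn => h n (GroupoidCStar.elementaryNormalizers_subset hn)
  tfae_have 2 → 1 := fun h => h.isTotallyBalanced μ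
  tfae_finish
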